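/- Work in the two-sorted language $L_2$ of second order arithmetic. A structure $M$ for $L_2$ consists of a set (also denoted $M$) over which number variables range, interpretations of $0,1,+,\cdot,<$ on it, and a nonempty collection of subsets of $M$ over which set variables range. "Set" below means a set of this collection, and everything is interpreted in $M$. A formula is $\Sigma^0_0$ if all its quantifiers are bounded number quantifiers, $\Sigma^0_1$ if it is of the form $\exists m\,\theta$, and $\Pi^0_1$ if it is of the form $\forall m\,\theta$, with $\theta$ a $\Sigma^0_0$ formula; number and set parameters from $M$ are allowed. $\mathsf{RCA}_0$ consists of the basic axioms of arithmetic ($n+1\neq 0$; $m+1=n+1\to m=n$; $m+0=m$; $m+(n+1)=(m+n)+1$; $m\cdot 0=0$; $m\cdot(n+1)=m\cdot n+m$; $\neg\, m<0$; $m<n+1\leftrightarrow (m<n\lor m=n)$), induction for $\Sigma^0_1$ formulas, and $\Delta^0_1$ comprehension; $\mathsf{WKL}_0$ is $\mathsf{RCA}_0$ together with weak König's lemma: every infinite tree $T\subseteq 2^{<\mathbb N}$ has a path. Pairs are coded by $(i,j)=(i+j)^2+i$; a finite set is coded by the least number of the form $(k,(m,n))$ such that its elements are exactly the $i<k$ for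 which $m(i+1)+1$ divides $n$; a finite sequence is a finite set of pairs that is a function on an initial segment $\{j: j<l\}$. A partial order $P$ is a set $P$ of numbers with a set ${\preceq}\subseteq P\times P$ (coded by pairs) that is reflexive, antisymmetric and transitive on $P$; a set $I\subseteq P$ is an initial interval of $P$ if $(\forall x,y\in P)(x\preceq y\land y\in I\implies x\in I)$. **Lemma.** Over $\mathsf{RCA}_0$ the following are equivalent, that is, for every (not necessarily standard) model $M$ of $\mathsf{RCA}_0$ the following are equivalent in $M$: 1. $\mathsf{WKL}_0$; 2. $\Sigma^0_1$ initial interval separation: let $P$ be a partial order and let $\varphi(x)$, $\psi(x)$ be $\Sigma^0_1$ formulas with one distinguished free number variable. If $(\forall x,y\in P)(\varphi(x)\land\psi(y)\implies y\npreceq x)$, then there exists an initial interval $I$ of $P$ such that $(\forall x\in P)\big((\varphi(x)\implies x\in I)\land(\psi(x)\implies x\notin I)\big)$; 3. initial interval separation: let $P$ be a partial order and let $A,B\subseteq P$ be sets such that $(\forall x\in A)(\forall y\in B)\; y\npreceq x$. Then there exists an initial interval $I$ of $P$ such that $A\subseteq I$ and $B\cap I=\emptyset$. -/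

import Mathlib

universe u

namespace RevMath

/-! ### Structures for the language of second order arithmetic -/

/-- A structure for the two-sorted language `L₂` of second order arithmetic: number variables range
over `M`, set variables range over a nonempty collection `sets` of subsets of `M`, and `0`, `1`,
`+`, `·`, `<` are interpreted arbitrarily. No axiom is assumed at this point; neither `M` nor the
collection of sets has to be standard. -/
class L2Structure (M : Type u) extends Zero M, One M, Add M, Mul M, LT M where
  /-- the range of the set variables -/
  sets : Set (Set M)
  sets_nonempty : sets.Nonempty

open L2Structure (sets)

/-! ### Arithmetical formulas with parameters -/

/-- Numerical terms with free variables `x₀, …, xₙ₋₁` and number parameters from `M`. -/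
inductive NumTerm (M : Type u) (n : ℕ) : Type u
  | var (i : Fin n) : NumTerm M n
  | param (a : M) : NumTerm M n
  | zero : NumTerm M n
  | one : NumTerm M n
  | add (s t : NumTerm M n) : NumTerm M n
  | mul (s t : NumTerm M n) : NumTerm M n

/-- Bounded quantifier (`Σ⁰₀`) formulas of `L₂` with free number variables `x₀, …, xₙ₋₁`, and with
number and set parameters from the structure `M`. A bounded quantifier binds the variable `x₀` of
its body, the other variables being shifted by one; hence the bounding term cannot contain the
bound variable. -/
inductive BddFormula (M : Type u) [L2Structure M] : ℕ → Type u
  | eq {n : ℕ} (s t : NumTerm M n) : BddFormula M n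
  | lt {n : ℕ} (s t : NumTerm M n) : BddFormula M n
  | mem {n : ℕ} (t : NumTerm M n) (X : {X : Set M // X ∈ sets (M := M)}) : BddFormula M n
  | neg {n : ℕ} (φ : BddFormula M n) : BddFormula M n
  | and {n : ℕ} (φ ψ : BddFormula M n) : BddFormula M n
  | or {n : ℕ} (φ ψ : BddFormula M n) : BddFormula M n
  | imp {n : ℕ} (φ ψ : BddFormula M n) : BddFormula M n
  | bdAll {n : ℕ} (t : NumTerm M n) (φ : BddFormula M (n + 1)) : BddFormula M n
  | bdEx {n : ℕ} (t : NumTerm M n) (φ : BddFormula M (n + 1)) : BddFormula M n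

variable {M : Type u} [L2Structure M]

/-- The value of a term. -/
def NumTerm.val {n : ℕ} (v : Fin n → M) : NumTerm M n → M
  | .var i => v i
  | .param a => a
  | .zero => 0
  | .one => 1
  | .add s t => s.val v + t.val v
  | .mul s t => s.val v * t.val v

/-- Satisfaction of a bounded quantifier formula. -/
def BddFormula.Sat : {n : ℕ} → BddFormula M n → (Fin n → M) → Prop
  | _, .eq s t, v => s.val v = t.val v
  | _, .lt s t, v => s.val v < t.val v
  | _, .mem t X, v => t.val v ∈ X.1
  | _, .neg φ, v => ¬ φ.Sat v
  | _, .and φ ψ, v => φ.Sat v ∧ ψ.Sat v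
  | _, .or φ ψ, v => φ.Sat v ∨ ψ.Sat v
  | _, .imp φ ψ, v => φ.Sat v → ψ.Sat v
  | _, .bdAll t φ, v => ∀ a : M, a < t.val v → φ.Sat (Matrix.vecCons a v)
  | _, .bdEx t φ, v => ∃ a : M, a < t.val v ∧ φ.Sat (Matrix.vecCons a v)

/-- `φ(x)` is given in `M` by a `Σ⁰₁` formula `∃ m, θ(m, x)`, with `θ` a bounded quantifier formula
with parameters. -/
def IsSigma01 (φ : M → Prop) : Prop :=
  ∃ θ : BddFormula M 2, ∀ x : M, φ x ↔ ∃ m : M, θ.Sat ![m, x]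

/-- `φ(x)` is given in `M` by a `Π⁰₁` formula `∀ m, θ(m, x)`, with `θ` a bounded quantifier formula
with parameters. -/
def IsPi01 (φ : M → Prop) : Prop :=
  ∃ θ : BddFormula M 2, ∀ x : M, φ x ↔ ∀ m : M, θ.Sat ![m, x]

/-! ### The system `RCA₀` -/

/-- `M` satisfies the axioms of `RCA₀`: the basic axioms of arithmetic, `Σ⁰₁` induction and
`Δ⁰₁` comprehension (the last two with number and set parameters). -/
structure ModelsRCA0 (M : Type u) [L2Structure M] : Prop where
  succ_ne_zero : ∀ n : M, n + 1 ≠ 0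
  succ_inj : ∀ m n : M, m + 1 = n + 1 → m = n
  add_zero : ∀ m : M, m + 0 = m
  add_succ : ∀ m n : M, m + (n + 1) = (m + n) + 1
  mul_zero : ∀ m : M, m * 0 = 0
  mul_succ : ∀ m n : M, m * (n + 1) = m * n + m
  not_lt_zero : ∀ m : M, ¬ m < 0
  lt_succ_iff : ∀ m n : M, m < n + 1 ↔ (m < n ∨ m = n)
  sigma01_induction : ∀ φ : M → Prop, IsSigma01 φ →
    φ 0 → (∀ n : M, φ n → φ (n + 1)) → ∀ n : M, φ n
  delta01_comprehension : ∀ φ ψ : M → Prop, IsSigma01 φ → IsPi01 ψ →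
    (∀ n : M, φ n ↔ ψ n) → ∃ X ∈ sets (M := M), ∀ n : M, n ∈ X ↔ φ n

/-! ### Coding of pairs, finite sets and finite sequences

These are the usual codings of second order arithmetic, read inside `M`: all quantifiers range over
`M`, so that a finite sequence may have a nonstandard length. -/

/-- The pair `(i, j) = (i + j)² + i`. -/
def pair (i j : M) : M := (i + j) * (i + j) + i

/-- `c = (k, (m, n))` for some `k, m, n`. -/
def IsTriple (c : M) : Prop := ∃ k m n : M, c = pair k (pair m n)

/-- `i` belongs to the finite set represented by the triple `c = (k, (m, n))`:
`i < k` and `m (i + 1) + 1` divides `n`. -/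
def InFin (i c : M) : Prop :=
  ∃ k m n : M, c = pair k (pair m n) ∧ i < k ∧ ∃ q : M, (m * (i + 1) + 1) * q = n

/-- `c` is the code of a finite set, i.e. the least triple representing that set. -/
def IsFinCode (c : M) : Prop :=
  IsTriple c ∧ ∀ d : M, d < c → IsTriple d → ¬ ∀ i : M, InFin i d ↔ InFin i c

/-- `σ` is (the code of) a finite sequence of numbers of length `l`: a finite set of pairs which is
a function with domain `{j : j < l}`. -/
def IsSeqLen (σ l : M) : Prop :=
  IsFinCode σ ∧
  (∀ i : M, InFin i σ → ∃ j k : M, i = pair j k) ∧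
  (∀ j k k' : M, InFin (pair j k) σ → InFin (pair j k') σ → k = k') ∧
  (∀ j : M, j < l ↔ ∃ k : M, InFin (pair j k) σ)

/-- `σ ∈ ℕ^{<ℕ}`. -/
def IsSeq (σ : M) : Prop := ∃ l : M, IsSeqLen σ l

/-- `σ ∈ 2^{<ℕ}`. -/
def IsBinSeq (σ : M) : Prop :=
  IsSeq σ ∧ ∀ j k : M, InFin (pair j k) σ → k = 0 ∨ k = 1

/-- `σ ⊑ τ`: the sequence `σ`, as a finite set of pairs, is contained in `τ`. -/
def IsInitSeg (σ τ : M) : Prop :=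
  IsSeq σ ∧ IsSeq τ ∧ ∀ i : M, InFin i σ → InFin i τ

/-! ### Weak König's lemma and `WKL₀` -/

/-- `T` is a tree contained in `2^{<ℕ}`. -/
def IsBinTree (T : Set M) : Prop :=
  (∀ σ ∈ T, IsBinSeq σ) ∧ ∀ σ τ : M, τ ∈ T → IsInitSeg σ τ → σ ∈ T

/-- `X` is infinite in the sense of `M`, i.e. unbounded. -/
def IsInfiniteIn (X : Set M) : Prop := ¬ ∃ k : M, ∀ i ∈ X, i < k

/-- `F` is (the set of pairs coding) a function from numbers to numbers. -/
def IsFun (F : Set M) : Prop :=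
  (∀ i ∈ F, ∃ a b : M, i = pair a b) ∧ ∀ a : M, ∃! b : M, pair a b ∈ F

/-- `F` is a path in `T`: a function all of whose restrictions `F ↾ n` belong to `T`. -/
def IsPath (F T : Set M) : Prop :=
  IsFun F ∧ ∀ n : M, ∃ σ ∈ T, IsSeqLen σ n ∧ ∀ i : M, InFin i σ → i ∈ F

/-- `M` satisfies weak König's lemma: every infinite subtree of `2^{<ℕ}` has a path. -/
def WeakKonig (M : Type u) [L2Structure M] : Prop :=
  ∀ T ∈ sets (M := M), IsBinTree T → IsInfiniteIn T → ∃ F ∈ sets (M := M), IsPath F T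

/-- `M` is a model of `WKL₀`, that is of `RCA₀` plus weak König's lemma. -/
def ModelsWKL0 (M : Type u) [L2Structure M] : Prop := ModelsRCA0 M ∧ WeakKonig M

/-! ### Partial orders and initial interval separation -/

/-- `R ⊆ P × P` (coded as a set of pairs) is a partial order on the set `P`;
`x ≼ y` means `pair x y ∈ R`. -/
structure IsPartialOrderOn (P R : Set M) : Prop where
  subset : ∀ i ∈ R, ∃ x ∈ P, ∃ y ∈ P, i = pair x y
  refl : ∀ x ∈ P, pair x x ∈ R
  antisymm : ∀ x ∈ P, ∀ y ∈ P, pair x y ∈ R → pair y x ∈ R → x = y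
  trans : ∀ x ∈ P, ∀ y ∈ P, ∀ z ∈ P, pair x y ∈ R → pair y z ∈ R → pair x z ∈ R

/-- `I` is an initial interval of the partial order `(P, R)`. -/
def IsInitialInterval (P R I : Set M) : Prop :=
  I ⊆ P ∧ ∀ x ∈ P, ∀ y ∈ P, pair x y ∈ R → y ∈ I → x ∈ I

/-- `M` satisfies `Σ⁰₁` initial interval separation (with number and set parameters). -/
def Sigma01InitialIntervalSeparation (M : Type u) [L2Structure M] : Prop :=
  ∀ P ∈ sets (M := M), ∀ R ∈ sets (M := M), IsPartialOrderOn P R →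
    ∀ φ ψ : M → Prop, IsSigma01 φ → IsSigma01 ψ →
      (∀ x ∈ P, ∀ y ∈ P, φ x ∧ ψ y → pair y x ∉ R) →
      ∃ I ∈ sets (M := M), IsInitialInterval P R I ∧
        ∀ x ∈ P, (φ x → x ∈ I) ∧ (ψ x → x ∉ I)

/-- `M` satisfies initial interval separation. -/
def InitialIntervalSeparation (M : Type u) [L2Structure M] : Prop :=
  ∀ P ∈ sets (M := M), ∀ R ∈ sets (M := M), IsPartialOrderOn P R →
    ∀ A ∈ sets (M := M), ∀ B ∈ sets (M := M), A ⊆ P → B ⊆ P →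
      (∀ x ∈ A, ∀ y ∈ B, pair y x ∉ R) →
      ∃ I ∈ sets (M := M), IsInitialInterval P R I ∧ A ⊆ I ∧ B ∩ I = ∅

end RevMath

/-! (2) → (3) is a special case, since membership in a set is Σ⁰₁.

For (1) → (2), write the two Σ⁰₁ formulas as `∃ m, pair m x ∈ S` and `∃ m, pair m x ∈ S'`. The
binary strings of length `l` that look like the characteristic function of a separating initial
interval, as far as points and witnesses below `l` can tell, form a tree (`IsApprox`). It has
strings of every length: take the downward closure of the points with an `S`-witness, everything
restricted to numbers below `l` (`exists_isApprox`). A path through the tree, intersected with `P`,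
is the interval.

For (3) → (1), initial interval separation first yields separation of disjoint Σ⁰₁ predicates φ, ψ:
a suitable order places `pair x 0` below a point of `A` when φ holds at `x`, and above a point of
`B` when ψ does (`InitialIntervalSeparation.sigma01_separation`). Given an infinite tree, separate
the strings for which, at some length `n`, only the continuation by 1 extends to length `n` from
those for which only the continuation by 0 does (`InitialIntervalSeparation.exists_choice`).
Following the separating set from the root never loses an available extension (`alive_of_follows`),
and the path so described is Δ⁰₁ because its finite approximations exist and agree.

Since `M` may be nonstandard, everything takes place inside `M`. Definability is checked by instance
search on `IsTerm`, `IsBdd` and `IsSig`. Finite sets are coded through pairwise coprime moduli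
(`IsModulus.exists_inFin`); a bound on the codes of all subsets of `{i : i < k}` (`IsCodeBound`)
makes quantification over such subsets bounded. -/

namespace RevMath

open L2Structure (sets)

set_option linter.unusedSectionVars false

/-! ### Definability by bounded quantifier formulas -/

/-- `Γ` is a context of finitely many number variables. -/
class Ctx (M : Type u) (Γ : Type u) where
  /-- the number of variables -/
  size : ℕ
  /-- the values of the variables -/
  env : Γ → Fin size → M

instance Ctx.instPUnit (M : Type u) : Ctx M PUnit.{u + 1} := ⟨0, fun _ => ![]⟩

instance Ctx.instProd (M Γ : Type u) [Ctx M Γ] : Ctx M (M × Γ) :=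
  ⟨Ctx.size M Γ + 1, fun p => Matrix.vecCons p.1 (Ctx.env p.2)⟩

section

variable (M : Type u) [L2Structure M] {Γ : Type u} [Ctx M Γ]

/-- The function `t` is given by a term with parameters. -/
class IsTerm (t : Γ → M) : Prop where
  out : ∃ τ : NumTerm M (Ctx.size M Γ), ∀ γ, τ.val (Ctx.env γ) = t γ

/-- The relation `P` is given by a bounded quantifier formula with parameters. -/
class IsBdd (P : Γ → Prop) : Prop where
  out : ∃ θ : BddFormula M (Ctx.size M Γ), ∀ γ, θ.Sat (Ctx.env γ) ↔ P γ

/-- The relation `P` is given by a `Σ⁰₁` formula with parameters. -/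
class IsSig (P : Γ → Prop) : Prop where
  out : ∃ θ : M × Γ → Prop, IsBdd M θ ∧ ∀ γ, P γ ↔ ∃ m, θ (m, γ)

end

section

variable {M : Type u} [L2Structure M] {Γ : Type u} [Ctx M Γ]

instance IsTerm.const (a : M) : IsTerm M (fun _ : Γ => a) := ⟨.param a, fun _ => rfl⟩

instance IsTerm.add (s t : Γ → M) [hs : IsTerm M s] [ht : IsTerm M t] :
    IsTerm M (fun γ => s γ + t γ) := by
  obtain ⟨σ, hσ⟩ := hs.out
  obtain ⟨τ, hτ⟩ := ht.out
  exact ⟨.add σ τ, fun γ => by simp [NumTerm.val, hσ, hτ]⟩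

instance IsTerm.mul (s t : Γ → M) [hs : IsTerm M s] [ht : IsTerm M t] :
    IsTerm M (fun γ => s γ * t γ) := by
  obtain ⟨σ, hσ⟩ := hs.out
  obtain ⟨τ, hτ⟩ := ht.out
  exact ⟨.mul σ τ, fun γ => by simp [NumTerm.val, hσ, hτ]⟩

instance IsTerm.pair (s t : Γ → M) [IsTerm M s] [IsTerm M t] :
    IsTerm M (fun γ => pair (s γ) (t γ)) := by
  unfold RevMath.pair
  infer_instance

/-- Substitution of terms for the variables of a term. -/
def NumTerm.subst {m n : ℕ} (f : Fin m → NumTerm M n) : NumTerm M m → NumTerm M n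
  | .var i => f i
  | .param a => .param a
  | .zero => .zero
  | .one => .one
  | .add s t => .add (s.subst f) (t.subst f)
  | .mul s t => .mul (s.subst f) (t.subst f)

theorem NumTerm.val_subst {m n : ℕ} (f : Fin m → NumTerm M n) (v : Fin n → M) (t : NumTerm M m) :
    (t.subst f).val v = t.val (fun i => (f i).val v) := by
  induction t <;> simp_all [NumTerm.subst, NumTerm.val]

/-- The terms substituted below a quantifier. -/
def NumTerm.under {m n : ℕ} (f : Fin m → NumTerm M n) : Fin (m + 1) → NumTerm M (n + 1) :=
  Fin.cons (.var 0) fun i => (f i).subst fun j => .var j.succ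

theorem NumTerm.val_under {m n : ℕ} (f : Fin m → NumTerm M n) (v : Fin n → M) (a : M) :
    (fun i => (NumTerm.under f i).val (Matrix.vecCons a v)) =
      Matrix.vecCons a (fun i => (f i).val v) := by
  funext i
  refine Fin.cases ?_ (fun i => ?_) i <;> simp [NumTerm.under, NumTerm.val, NumTerm.val_subst]

/-- Substitution of terms for the free variables of a bounded quantifier formula. -/
def BddFormula.subst : {m n : ℕ} → (Fin m → NumTerm M n) → BddFormula M m → BddFormula M n
  | _, _, f, .eq s t => .eq (s.subst f) (t.subst f)
  | _, _, f, .lt s t => .lt (s.subst f) (t.subst f)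
  | _, _, f, .mem t X => .mem (t.subst f) X
  | _, _, f, .neg φ => .neg (φ.subst f)
  | _, _, f, .and φ ψ => .and (φ.subst f) (ψ.subst f)
  | _, _, f, .or φ ψ => .or (φ.subst f) (ψ.subst f)
  | _, _, f, .imp φ ψ => .imp (φ.subst f) (ψ.subst f)
  | _, _, f, .bdAll t φ => .bdAll (t.subst f) (φ.subst (NumTerm.under f))
  | _, _, f, .bdEx t φ => .bdEx (t.subst f) (φ.subst (NumTerm.under f))

theorem BddFormula.sat_subst {m n : ℕ} (f : Fin m → NumTerm M n) (φ : BddFormula M m)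
    (v : Fin n → M) : (φ.subst f).Sat v ↔ φ.Sat (fun i => (f i).val v) := by
  induction φ generalizing n <;>
    simp_all [BddFormula.subst, BddFormula.Sat, NumTerm.val_subst, NumTerm.val_under]

/-- The map `f` between contexts is given by terms with parameters. -/
class IsTermMap {Γ Δ : Type u} [Ctx M Γ] [Ctx M Δ] (f : Γ → Δ) : Prop where
  out : ∀ i, IsTerm M (fun γ => Ctx.env (M := M) (f γ) i)

instance IsTermMap.const (a : PUnit.{u + 1}) : IsTermMap (M := M) (fun _ : Γ => a) :=
  ⟨fun i => i.elim0⟩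

instance IsTermMap.pair {Δ : Type u} [Ctx M Δ] (t : Γ → M) (f : Γ → Δ) [ht : IsTerm M t]
    [hf : IsTermMap (M := M) f] : IsTermMap (M := M) (fun γ => (t γ, f γ)) :=
  ⟨fun i => Fin.cases ht (fun j => hf.out j) i⟩

instance IsTermMap.snd : IsTermMap (M := M) (fun p : M × Γ => p.2) :=
  ⟨fun i => ⟨.var i.succ, fun _ => rfl⟩⟩

theorem IsTermMap.comp_snd {Δ : Type u} [Ctx M Δ] (f : Γ → Δ) [hf : IsTermMap (M := M) f] :
    IsTermMap (M := M) (fun p : M × Γ => f p.2) := by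
  refine ⟨fun i => ?_⟩
  obtain ⟨τ, hτ⟩ := (hf.out i).out
  refine ⟨τ.subst fun j => .var j.succ, fun p => ?_⟩
  rw [NumTerm.val_subst, ← hτ]
  rfl

instance IsTermMap.snd2 : IsTermMap (M := M) (fun p : M × M × Γ => p.2.2) :=
  IsTermMap.comp_snd (fun p : M × Γ => p.2)

instance IsTermMap.snd3 : IsTermMap (M := M) (fun p : M × M × M × Γ => p.2.2.2) :=
  IsTermMap.comp_snd (fun p : M × M × Γ => p.2.2)

theorem IsTerm.comp {Δ : Type u} [Ctx M Δ] (f : Γ → Δ) [hf : IsTermMap (M := M) f]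
    (t : Δ → M) [ht : IsTerm M t] : IsTerm M (fun γ => t (f γ)) := by
  choose σ hσ using fun i => (hf.out i).out
  obtain ⟨τ, hτ⟩ := ht.out
  refine ⟨τ.subst σ, fun p => ?_⟩
  rw [NumTerm.val_subst, ← hτ]
  simp only [hσ]

/-- Substitution in formulas; it is what allows variables to be dropped, permuted or replaced by
terms. -/
theorem IsBdd.comp {Δ : Type u} [Ctx M Δ] (f : Γ → Δ) [hf : IsTermMap (M := M) f]
    (P : Δ → Prop) [hP : IsBdd M P] : IsBdd M (fun γ => P (f γ)) := by
  choose σ hσ using fun i => (hf.out i).out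
  obtain ⟨τ, hτ⟩ := hP.out
  refine ⟨τ.subst σ, fun p => ?_⟩
  rw [BddFormula.sat_subst, ← hτ]
  simp only [hσ]

instance IsTerm.var0 : IsTerm M (fun γ : M × Γ => γ.1) := ⟨.var (0 : Fin (_ + 1)), fun _ => rfl⟩

instance IsTerm.var1 :
    IsTerm M (fun γ : M × M × Γ => γ.2.1) :=
  IsTerm.comp Prod.snd (fun γ : M × Γ => γ.1)
instance IsTerm.var2 :
    IsTerm M (fun γ : M × M × M × Γ => γ.2.2.1) :=
  IsTerm.comp Prod.snd (fun γ : M × M × Γ => γ.2.1)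
instance IsTerm.var3 :
    IsTerm M (fun γ : M × M × M × M × Γ => γ.2.2.2.1) :=
  IsTerm.comp Prod.snd (fun γ : M × M × M × Γ => γ.2.2.1)
instance IsTerm.var4 :
    IsTerm M (fun γ : M × M × M × M × M × Γ => γ.2.2.2.2.1) :=
  IsTerm.comp Prod.snd (fun γ : M × M × M × M × Γ => γ.2.2.2.1)

/-! ### Closure of bounded formulas under connectives and bounded quantifiers. -/

instance IsBdd.eq (s t : Γ → M) [hs : IsTerm M s] [ht : IsTerm M t] :
    IsBdd M (fun γ => s γ = t γ) := by
  obtain ⟨σ, hσ⟩ := hs.out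
  obtain ⟨τ, hτ⟩ := ht.out
  exact ⟨.eq σ τ, fun γ => by simp [BddFormula.Sat, hσ, hτ]⟩

instance IsBdd.lt (s t : Γ → M) [hs : IsTerm M s] [ht : IsTerm M t] :
    IsBdd M (fun γ => s γ < t γ) := by
  obtain ⟨σ, hσ⟩ := hs.out
  obtain ⟨τ, hτ⟩ := ht.out
  exact ⟨.lt σ τ, fun γ => by simp [BddFormula.Sat, hσ, hτ]⟩

instance IsBdd.mem (t : Γ → M) (X : Set M) [hX : Fact (X ∈ sets (M := M))] [ht : IsTerm M t] :
    IsBdd M (fun γ => t γ ∈ X) := by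
  obtain ⟨τ, hτ⟩ := ht.out
  exact ⟨.mem τ ⟨X, hX.out⟩, fun γ => by simp [BddFormula.Sat, hτ]⟩

instance IsBdd.not (P : Γ → Prop) [hP : IsBdd M P] : IsBdd M (fun γ => ¬ P γ) := by
  obtain ⟨σ, hσ⟩ := hP.out
  exact ⟨.neg σ, fun γ => by simp [BddFormula.Sat, hσ]⟩

instance IsBdd.and (P Q : Γ → Prop) [hP : IsBdd M P] [hQ : IsBdd M Q] :
    IsBdd M (fun γ => P γ ∧ Q γ) := by
  obtain ⟨σ, hσ⟩ := hP.out
  obtain ⟨τ, hτ⟩ := hQ.out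
  exact ⟨.and σ τ, fun γ => by simp [BddFormula.Sat, hσ, hτ]⟩

instance IsBdd.or (P Q : Γ → Prop) [hP : IsBdd M P] [hQ : IsBdd M Q] :
    IsBdd M (fun γ => P γ ∨ Q γ) := by
  obtain ⟨σ, hσ⟩ := hP.out
  obtain ⟨τ, hτ⟩ := hQ.out
  exact ⟨.or σ τ, fun γ => by simp [BddFormula.Sat, hσ, hτ]⟩

instance IsBdd.imp (P Q : Γ → Prop) [hP : IsBdd M P] [hQ : IsBdd M Q] :
    IsBdd M (fun γ => P γ → Q γ) := by
  obtain ⟨σ, hσ⟩ := hP.out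
  obtain ⟨τ, hτ⟩ := hQ.out
  exact ⟨.imp σ τ, fun γ => by simp [BddFormula.Sat, hσ, hτ]⟩

theorem IsBdd.congr {P Q : Γ → Prop} (h : IsBdd M P) (e : ∀ γ, Q γ ↔ P γ) : IsBdd M Q :=
  (funext fun γ => propext (e γ) : Q = P) ▸ h

instance IsBdd.iff (P Q : Γ → Prop) [IsBdd M P] [IsBdd M Q] :
    IsBdd M (fun γ => P γ ↔ Q γ) :=
  (inferInstance : IsBdd M fun γ => (P γ → Q γ) ∧ (Q γ → P γ)).congr fun _ => iff_iff_implies_and_implies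

instance IsBdd.bdAll (t : Γ → M) (P : Γ → M → Prop) [ht : IsTerm M t]
    [hP : IsBdd M (fun p : M × Γ => P p.2 p.1)] :
    IsBdd M (fun γ => ∀ a, a < t γ → P γ a) := by
  obtain ⟨τ, hτ⟩ := ht.out
  obtain ⟨θ, hθ⟩ := hP.out
  refine ⟨.bdAll τ θ, fun γ => ?_⟩
  simp only [BddFormula.Sat, hτ]
  exact forall₂_congr fun a _ => hθ (a, γ)

instance IsBdd.bdEx (t : Γ → M) (P : Γ → M → Prop) [ht : IsTerm M t]
    [hP : IsBdd M (fun p : M × Γ => P p.2 p.1)] :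
    IsBdd M (fun γ => ∃ a, a < t γ ∧ P γ a) := by
  obtain ⟨τ, hτ⟩ := ht.out
  obtain ⟨θ, hθ⟩ := hP.out
  refine ⟨.bdEx τ θ, fun γ => ?_⟩
  simp only [BddFormula.Sat, hτ]
  exact exists_congr fun a => and_congr_right fun _ => hθ (a, γ)

theorem isSigma01_iff {φ : M → Prop} :
    IsSigma01 φ ↔ IsSig M (fun γ : M × PUnit.{u + 1} => φ γ.1) := by
  constructor
  · rintro ⟨θ, hθ⟩
    exact ⟨fun p => θ.Sat ![p.1, p.2.1], ⟨θ, fun _ => Iff.rfl⟩, fun γ => hθ γ.1⟩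
  · rintro ⟨θ, ⟨τ, hτ⟩, h⟩
    exact ⟨τ, fun x => (h (x, ⟨⟩)).trans (exists_congr fun m => (hτ (m, (x, ⟨⟩))).symm)⟩

theorem isPi01_iff {φ : M → Prop} :
    IsPi01 φ ↔ IsSig M (fun γ : M × PUnit.{u + 1} => ¬ φ γ.1) := by
  rw [← isSigma01_iff (φ := fun x => ¬ φ x)]
  constructor
  · rintro ⟨θ, hθ⟩
    exact ⟨.neg θ, fun x => by simp [hθ, BddFormula.Sat]⟩
  · rintro ⟨θ, hθ⟩
    refine ⟨.neg θ, fun x => ?_⟩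
    have := not_congr (hθ x)
    simpa [BddFormula.Sat] using this

/-- This and the next two lemmas turn definability of a fixed relation into an instance for
arbitrary terms in any context. -/
theorem IsBdd.comp₁ {P : M → Prop} (hP : IsBdd M (fun γ : M × PUnit.{u + 1} => P γ.1))
    (t : Γ → M) [IsTerm M t] : IsBdd M (fun γ => P (t γ)) :=
  IsBdd.comp (fun γ => (t γ, PUnit.unit)) (fun γ : M × PUnit.{u + 1} => P γ.1)

theorem IsBdd.comp₂ {P : M → M → Prop}
    (hP : IsBdd M (fun γ : M × M × PUnit.{u + 1} => P γ.1 γ.2.1))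
    (s t : Γ → M) [IsTerm M s] [IsTerm M t] : IsBdd M (fun γ => P (s γ) (t γ)) :=
  IsBdd.comp (fun γ => (s γ, t γ, PUnit.unit)) (fun γ : M × M × PUnit.{u + 1} => P γ.1 γ.2.1)

theorem IsBdd.comp₃ {P : M → M → M → Prop}
    (hP : IsBdd M (fun γ : M × M × M × PUnit.{u + 1} => P γ.1 γ.2.1 γ.2.2.1))
    (r s t : Γ → M) [IsTerm M r] [IsTerm M s] [IsTerm M t] :
    IsBdd M (fun γ => P (r γ) (s γ) (t γ)) :=
  IsBdd.comp (fun γ => (r γ, s γ, t γ, PUnit.unit))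
    (fun γ : M × M × M × PUnit.{u + 1} => P γ.1 γ.2.1 γ.2.2.1)

/-- The unbounded quantifier is a dummy. The low priority makes the structural rules for Σ⁰₁
formulas apply first. -/
instance (priority := low) IsSig.of_isBdd (P : Γ → Prop) [IsBdd M P] : IsSig M P :=
  ⟨fun p => P p.2, IsBdd.comp Prod.snd P, fun _ => ⟨fun h => ⟨0, h⟩, fun ⟨_, h⟩ => h⟩⟩

theorem IsSig.congr {P Q : Γ → Prop} (h : IsSig M P) (e : ∀ γ, Q γ ↔ P γ) : IsSig M Q :=
  (funext fun γ => propext (e γ) : Q = P) ▸ h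

end

/-! ### Basic arithmetic in a model of `RCA₀` -/

section

variable {M : Type u} [L2Structure M] [hM : Fact (ModelsRCA0 M)] {Γ : Type u} [Ctx M Γ]

theorem sig_induction {P : M → Prop} (hP : IsSig M (fun γ : M × PUnit.{u + 1} => P γ.1))
    (h0 : P 0) (hs : ∀ n, P n → P (n + 1)) (n : M) : P n :=
  hM.out.sigma01_induction P (isSigma01_iff.2 hP) h0 hs n

namespace Arith

theorem zero_add (n : M) : 0 + n = n :=
  sig_induction (P := fun n => 0 + n = n) inferInstance (hM.out.add_zero 0)
    (fun n h => by rw [hM.out.add_succ, h]) n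

theorem succ_add (m n : M) : (m + 1) + n = (m + n) + 1 :=
  sig_induction (P := fun n => (m + 1) + n = (m + n) + 1) inferInstance
    (by rw [hM.out.add_zero, hM.out.add_zero])
    (fun n h => by rw [hM.out.add_succ, h, hM.out.add_succ]) n

theorem add_comm (m n : M) : m + n = n + m :=
  sig_induction (P := fun n => m + n = n + m) inferInstance
    (by rw [hM.out.add_zero, zero_add])
    (fun n h => by rw [hM.out.add_succ, h, succ_add]) n

theorem add_assoc (k m n : M) : k + m + n = k + (m + n) :=
  sig_induction (P := fun n => k + m + n = k + (m + n)) inferInstance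
    (by rw [hM.out.add_zero, hM.out.add_zero])
    (fun n h => by rw [hM.out.add_succ, h, hM.out.add_succ, hM.out.add_succ]) n

theorem zero_mul (n : M) : 0 * n = 0 :=
  sig_induction (P := fun n => 0 * n = 0) inferInstance (hM.out.mul_zero 0)
    (fun n h => by rw [hM.out.mul_succ, h, hM.out.add_zero]) n

theorem succ_mul (m n : M) : (m + 1) * n = m * n + n :=
  sig_induction (P := fun n => (m + 1) * n = m * n + n) inferInstance
    (by rw [hM.out.mul_zero, hM.out.mul_zero, hM.out.add_zero])
    (fun n h => by
      rw [hM.out.mul_succ, h, hM.out.mul_succ, add_assoc, add_assoc, ← add_assoc n m 1,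
        ← add_assoc m n 1, add_comm n m]) n

theorem mul_comm (m n : M) : m * n = n * m :=
  sig_induction (P := fun n => m * n = n * m) inferInstance
    (by rw [hM.out.mul_zero, zero_mul])
    (fun n h => by rw [hM.out.mul_succ, h, succ_mul]) n

theorem mul_add (k m n : M) : k * (m + n) = k * m + k * n :=
  sig_induction (P := fun n => k * (m + n) = k * m + k * n) inferInstance
    (by rw [hM.out.add_zero, hM.out.mul_zero, hM.out.add_zero])
    (fun n h => by rw [hM.out.add_succ, hM.out.mul_succ, h, hM.out.mul_succ, add_assoc]) n

theorem mul_assoc (k m n : M) : k * m * n = k * (m * n) :=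
  sig_induction (P := fun n => k * m * n = k * (m * n)) inferInstance
    (by rw [hM.out.mul_zero, hM.out.mul_zero, hM.out.mul_zero])
    (fun n h => by rw [hM.out.mul_succ, h, hM.out.mul_succ, mul_add]) n

theorem mul_one (n : M) : n * 1 = n := by
  rw [← zero_add 1, hM.out.mul_succ, hM.out.mul_zero, zero_add]

end Arith

/-- The operations are those of the structure, so `ring` proves identities in `M`. There is no
subtraction. -/
instance : CommSemiring M where
  add_assoc := Arith.add_assoc
  zero_add := Arith.zero_add
  add_zero := hM.out.add_zero
  add_comm := Arith.add_comm
  left_distrib := Arith.mul_add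
  right_distrib a b c := by rw [Arith.mul_comm, Arith.mul_add, Arith.mul_comm c, Arith.mul_comm c]
  zero_mul := Arith.zero_mul
  mul_zero := hM.out.mul_zero
  mul_assoc := Arith.mul_assoc
  one_mul a := by rw [Arith.mul_comm, Arith.mul_one]
  mul_one := Arith.mul_one
  mul_comm := Arith.mul_comm
  nsmul := nsmulRec
  npow := npowRec

namespace Arith

theorem lt_add_succ (m n : M) : m < m + n + 1 :=
  sig_induction (P := fun n => m < m + n + 1) inferInstance
    ((hM.out.lt_succ_iff _ _).2 (.inr (hM.out.add_zero m).symm))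
    (fun n h => by
      rw [hM.out.lt_succ_iff, hM.out.add_succ]
      exact .inl h) n

theorem exists_of_lt {m n : M} : m < n → ∃ k, n = m + k + 1 := by
  -- The implication is phrased as a disjunction with a negated Σ⁰₀ formula, so that the induction
  -- predicate is Σ⁰₁.
  have : ¬ m < n ∨ ∃ k, n = m + k + 1 := by
    refine sig_induction (P := fun n => ¬ m < n ∨ ∃ k, n = m + k + 1)
      ⟨fun p => ¬ m < p.2.1 ∨ p.2.1 = m + p.1 + 1, inferInstance, fun γ => ?_⟩
      (.inl (hM.out.not_lt_zero m)) (fun n h => ?_) n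
    · by_cases h : m < γ.1
      · simp [h]
      · simp only [h, not_false_eq_true, true_or, true_iff]
        exact ⟨0, trivial⟩
    · rw [hM.out.lt_succ_iff]
      rcases h with h | ⟨k, hk⟩
      · by_cases e : m = n
        · exact .inr ⟨0, by rw [e, hM.out.add_zero]⟩
        · exact .inl (by tauto)
      · exact .inr ⟨k + 1, by rw [hk, hM.out.add_succ]⟩
  tauto

theorem zero_or_pos (n : M) : n = 0 ∨ 0 < n :=
  sig_induction (P := fun n : M => n = (0 : M) ∨ (0 : M) < n) inferInstance (.inl rfl)
    (fun n _ => .inr (by simpa [_root_.zero_add] using lt_add_succ 0 n)) n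

theorem trichotomy (m n : M) : m < n ∨ m = n ∨ n < m := by
  refine sig_induction (P := fun n => m < n ∨ m = n ∨ n < m) inferInstance
    (.inr (zero_or_pos m)) (fun n h => ?_) n
  rcases h with h | h | h
  · exact .inl ((hM.out.lt_succ_iff _ _).2 (.inl h))
  · exact .inl ((hM.out.lt_succ_iff _ _).2 (.inr h))
  · obtain ⟨k, rfl⟩ := exists_of_lt h
    rcases zero_or_pos k with rfl | hk
    · exact .inr (.inl (by simp))
    · obtain ⟨l, rfl⟩ := exists_of_lt hk
      refine .inr (.inr ?_)
      have := lt_add_succ (n + 1) l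
      convert this using 1
      ring

theorem add_left_cancel' (k m n : M) : k + m = k + n → m = n :=
  sig_induction (P := fun k => k + m = k + n → m = n) inferInstance
    (fun h => by simpa using h)
    (fun k ih h => ih (hM.out.succ_inj _ _ (by
      rw [← succ_add, ← succ_add]
      exact h))) k

theorem lt_irrefl' (m : M) : ¬ m < m := fun h => by
  obtain ⟨k, hk⟩ := exists_of_lt h
  refine hM.out.succ_ne_zero k (add_left_cancel' m _ _ ?_)
  rw [← _root_.add_assoc]
  simpa using hk.symm

theorem lt_trans' {k m n : M} (h : k < m) (h' : m < n) : k < n := by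
  obtain ⟨a, rfl⟩ := exists_of_lt h
  obtain ⟨b, rfl⟩ := exists_of_lt h'
  convert lt_add_succ k (a + 1 + b) using 1
  ring

end Arith

/-! ### The ordered semiring structure of `M`. -/

noncomputable instance : LinearOrder M where
  le m n := m < n ∨ m = n
  le_refl m := .inr rfl
  le_trans k m n := by
    rintro (h | rfl) (h' | rfl)
    · exact .inl (Arith.lt_trans' h h')
    · exact .inl h
    · exact .inl h'
    · exact .inr rfl
  le_antisymm m n := by
    rintro (h | rfl) (h' | h')
    · exact (Arith.lt_irrefl' _ (Arith.lt_trans' h h')).elim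
    · exact h'.symm
    · rfl
    · rfl
  le_total m n := by
    rcases Arith.trichotomy m n with h | h | h
    · exact .inl (.inl h)
    · exact .inl (.inr h)
    · exact .inr (.inl h)
  lt_iff_le_not_ge m n := by
    constructor
    · intro h
      refine ⟨.inl h, ?_⟩
      rintro (h' | rfl)
      · exact Arith.lt_irrefl' _ (Arith.lt_trans' h h')
      · exact Arith.lt_irrefl' _ h
    · rintro ⟨h | rfl, h'⟩
      · exact h
      · exact (h' (.inr rfl)).elim
  toDecidableLE := Classical.decRel _

theorem lt_add_one_iff_le {m n : M} : m < n + 1 ↔ m ≤ n := hM.out.lt_succ_iff m n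

theorem lt_iff_exists_add_one {m n : M} : m < n ↔ ∃ k, n = m + k + 1 :=
  ⟨Arith.exists_of_lt, by rintro ⟨k, rfl⟩; exact Arith.lt_add_succ m k⟩

instance : IsCancelAdd M where
  add_left_cancel := Arith.add_left_cancel'
  add_right_cancel a b c h := by
    refine Arith.add_left_cancel' a _ _ ?_
    rw [_root_.add_comm a, _root_.add_comm a]
    exact h

instance : CanonicallyOrderedAdd M where
  exists_add_of_le {a b} h := by
    rcases h with h | rfl
    · obtain ⟨k, rfl⟩ := lt_iff_exists_add_one.1 h
      exact ⟨k + 1, by ring⟩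
    · exact ⟨0, by simp⟩
  le_add_self a b := by
    rw [← lt_add_one_iff_le, lt_iff_exists_add_one]
    exact ⟨b, by ring⟩
  le_self_add a b := by
    rw [← lt_add_one_iff_le, lt_iff_exists_add_one]
    exact ⟨b, by ring⟩

instance : IsOrderedAddMonoid M where
  add_le_add_left a b h c := by
    obtain ⟨d, rfl⟩ := exists_add_of_le h
    exact le_iff_exists_add.2 ⟨d, by ring⟩

instance : IsOrderedCancelAddMonoid M where
  le_of_add_le_add_left a b c h := by
    obtain ⟨d, hd⟩ := exists_add_of_le h
    exact le_iff_exists_add.2 ⟨d, add_left_cancel (a := a) (by rw [hd]; ring)⟩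

theorem add_one_le_iff_lt {m n : M} : m + 1 ≤ n ↔ m < n := by
  rw [← lt_add_one_iff_le]
  simp

instance : Nontrivial M := ⟨0, 1, fun h => hM.out.succ_ne_zero 0 (by simpa using h.symm)⟩

instance : IsStrictOrderedRing M where
  zero_le_one := zero_le
  mul_lt_mul_of_pos_left a ha b c h := by
    obtain ⟨k, rfl⟩ := lt_iff_exists_add_one.1 h
    obtain ⟨l, rfl⟩ := lt_iff_exists_add_one.1 ha
    exact lt_iff_exists_add_one.2 ⟨(0 + l + 1) * k + l, by ring⟩
  mul_lt_mul_of_pos_right a ha b c h := by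
    obtain ⟨k, rfl⟩ := lt_iff_exists_add_one.1 h
    obtain ⟨l, rfl⟩ := lt_iff_exists_add_one.1 ha
    exact lt_iff_exists_add_one.2 ⟨(0 + l + 1) * k + l, by ring⟩

end

section

variable {M : Type u} [L2Structure M] [hM : Fact (ModelsRCA0 M)] {Γ : Type u} [Ctx M Γ]

/-! ### Closure properties, least number principle and comprehension -/

instance IsBdd.le (s t : Γ → M) [IsTerm M s] [IsTerm M t] : IsBdd M (fun γ => s γ ≤ t γ) :=
  (inferInstance : IsBdd M fun γ => s γ < t γ + 1).congr fun _ => lt_add_one_iff_le.symm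

instance IsBdd.bdEx_le (t : Γ → M) (P : Γ → M → Prop) [IsTerm M t]
    [IsBdd M (fun p : M × Γ => P p.2 p.1)] : IsBdd M (fun γ => ∃ a, a ≤ t γ ∧ P γ a) :=
  (inferInstance : IsBdd M fun γ => ∃ a, a < t γ + 1 ∧ P γ a).congr fun _ => by
    simp only [lt_add_one_iff_le]

/-- Two unbounded quantifiers merge into one: both witnesses are bounded by their maximum. -/
instance IsSig.ex (P : Γ → M → Prop) [h : IsSig M (fun p : M × Γ => P p.2 p.1)] :
    IsSig M (fun γ => ∃ a, P γ a) := by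
  obtain ⟨θ, hθ, e⟩ := h.out
  have : IsBdd M (fun p : M × M × M × Γ => θ (p.1, p.2.1, p.2.2.2)) :=
    IsBdd.comp (fun p : M × M × M × Γ => (p.1, p.2.1, p.2.2.2)) θ
  refine ⟨fun p => ∃ a, a ≤ p.1 ∧ ∃ m, m ≤ p.1 ∧ θ (m, a, p.2), inferInstance, fun γ => ?_⟩
  constructor
  · rintro ⟨a, ha⟩
    obtain ⟨m, hm⟩ := (e (a, γ)).1 ha
    exact ⟨max a m, a, le_max_left _ _, m, le_max_right _ _, hm⟩
  · rintro ⟨w, a, -, m, -, hm⟩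
    exact ⟨a, (e (a, γ)).2 ⟨m, hm⟩⟩

instance IsSig.and (P Q : Γ → Prop) [hP : IsSig M P] [hQ : IsSig M Q] :
    IsSig M (fun γ => P γ ∧ Q γ) := by
  obtain ⟨θ, hθ, e⟩ := hP.out
  obtain ⟨η, hη, e'⟩ := hQ.out
  have : IsBdd M (fun p : M × M × Γ => θ (p.1, p.2.2)) :=
    IsBdd.comp (fun p : M × M × Γ => (p.1, p.2.2)) θ
  have : IsBdd M (fun p : M × M × Γ => η (p.2.1, p.2.2)) :=
    IsBdd.comp (fun p : M × M × Γ => (p.2.1, p.2.2)) η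
  exact (inferInstance : IsSig M fun γ => ∃ a b, θ (b, γ) ∧ η (a, γ)).congr fun γ => by
    rw [e, e']
    exact ⟨fun ⟨⟨b, hb⟩, a, ha⟩ => ⟨a, b, hb, ha⟩, fun ⟨a, b, hb, ha⟩ => ⟨⟨b, hb⟩, a, ha⟩⟩

instance IsSig.or (P Q : Γ → Prop) [hP : IsSig M P] [hQ : IsSig M Q] :
    IsSig M (fun γ => P γ ∨ Q γ) := by
  obtain ⟨θ, hθ, e⟩ := hP.out
  obtain ⟨η, hη, e'⟩ := hQ.out
  have : IsBdd M (fun p : M × Γ => θ (p.1, p.2)) := hθ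
  have : IsBdd M (fun p : M × Γ => η (p.1, p.2)) := hη
  exact (inferInstance : IsSig M fun γ => ∃ a, θ (a, γ) ∨ η (a, γ)).congr fun γ => by
    rw [e, e', exists_or]

theorem exists_least {P : M → Prop} (hP : IsBdd M (fun γ : M × PUnit.{u + 1} => P γ.1))
    {n : M} (hn : P n) : ∃ m, m ≤ n ∧ P m ∧ ∀ k, k < m → ¬ P k := by
  by_contra hc
  push Not at hc
  have := hP.comp₁ (fun γ : M × M × PUnit.{u + 1} => γ.1)
  -- The assumption `hc` supplies smaller solutions only for numbers up to `n`, hence the guard on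
  -- `l`.
  have key : ∀ l : M, l ≤ n + 1 → ∀ k, k < l → ¬ P k := by
    refine sig_induction inferInstance (fun _ k hk => (hM.out.not_lt_zero k hk).elim) fun l ih hl k hk => ?_
    rcases (lt_add_one_iff_le.1 hk).lt_or_eq with h | rfl
    · exact ih (le_self_add.trans hl) k h
    · intro hk
      obtain ⟨j, hj, hj'⟩ := hc k (by simpa using hl) hk
      exact ih (le_self_add.trans hl) j hj hj'
  exact key _ le_rfl n (lt_add_one_iff_le.2 le_rfl) hn

theorem exists_set {P : M → Prop} (h : IsSig M (fun γ : M × PUnit.{u + 1} => P γ.1))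
    (h' : IsSig M (fun γ : M × PUnit.{u + 1} => ¬ P γ.1)) :
    ∃ X ∈ sets (M := M), ∀ x, x ∈ X ↔ P x :=
  hM.out.delta01_comprehension P P (isSigma01_iff.2 h) (isPi01_iff.2 h') fun _ => Iff.rfl

theorem exists_set_of_isBdd (P : M → Prop) [IsBdd M (fun γ : M × PUnit.{u + 1} => P γ.1)] :
    ∃ X ∈ sets (M := M), ∀ x, x ∈ X ↔ P x :=
  exists_set inferInstance inferInstance

/-! ### Pairs -/

theorem le_mul_self' (x : M) : x ≤ x * x := by
  rcases eq_zero_or_pos x with rfl | h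
  · simp
  · exact le_mul_of_one_le_left zero_le (by simpa using add_one_le_iff_lt.2 h)

theorem left_le_pair (i j : M) : i ≤ pair i j := le_add_self

theorem right_le_pair (i j : M) : j ≤ pair i j :=
  (le_add_self.trans (le_mul_self' (i + j))).trans le_self_add

theorem pair_mono {i i' j j' : M} (h : i ≤ i') (h' : j ≤ j') : pair i j ≤ pair i' j' := by
  unfold pair
  gcongr

/-- The code of `(i, j)` lies between `(i + j)²` and `(i + j + 1)²`, so it determines the sum first
and then `i`. -/
theorem pair_lt_of_add_lt {i i' j j' : M} (h : i + j < i' + j') : pair i j < pair i' j' := by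
  have h1 := add_one_le_iff_lt.2 h
  calc pair i j < (i + j + 1) * (i + j + 1) :=
        lt_iff_exists_add_one.2 ⟨i + j + j, by unfold pair; ring⟩
    _ ≤ (i' + j') * (i' + j') := by gcongr
    _ ≤ pair i' j' := le_self_add

theorem pair_inj {i i' j j' : M} : pair i j = pair i' j' ↔ i = i' ∧ j = j' := by
  refine ⟨fun h => ?_, by rintro ⟨rfl, rfl⟩; rfl⟩
  have hs : i + j = i' + j' := by
    rcases lt_trichotomy (i + j) (i' + j') with h' | h' | h'
    · exact ((pair_lt_of_add_lt h').ne h).elim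
    · exact h'
    · exact ((pair_lt_of_add_lt h').ne h.symm).elim
  have hi : i = i' := by
    unfold pair at h
    rw [hs] at h
    exact add_left_cancel h
  subst hi
  exact ⟨rfl, add_left_cancel hs⟩

/-! ### Codes of finite sets -/

theorem isBdd_dvd : IsBdd M (fun γ : M × M × PUnit.{u + 1} => γ.1 ∣ γ.2.1) :=
  (inferInstance : IsBdd M fun γ : M × M × PUnit.{u + 1} =>
    ∃ q, q ≤ γ.2.1 ∧ γ.2.1 = γ.1 * q).congr fun γ => by
    constructor
    · rintro ⟨q, hq⟩
      -- A quotient by zero is arbitrary and need not be bounded; 0 replaces it.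
      rcases eq_zero_or_pos γ.1 with h | h
      · exact ⟨0, zero_le, by simpa [h] using hq⟩
      · refine ⟨q, ?_, hq⟩
        rw [hq]
        exact le_mul_of_one_le_left zero_le (by simpa using add_one_le_iff_lt.2 h)
    · rintro ⟨q, -, hq⟩
      exact ⟨q, hq⟩

instance IsBdd.dvd (s t : Γ → M) [IsTerm M s] [IsTerm M t] : IsBdd M (fun γ => s γ ∣ t γ) :=
  isBdd_dvd.comp₂ s t

theorem inFin_pair {i k m n : M} :
    InFin i (pair k (pair m n)) ↔ i < k ∧ m * (i + 1) + 1 ∣ n := by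
  constructor
  · rintro ⟨k', m', n', h, hi, q, hq⟩
    obtain ⟨hk, h⟩ := pair_inj.1 h
    obtain ⟨hm, hn⟩ := pair_inj.1 h
    rw [hk, hm, hn]
    exact ⟨hi, q, hq.symm⟩
  · rintro ⟨hi, q, hq⟩
    exact ⟨k, m, n, rfl, hi, q, hq.symm⟩

theorem InFin.lt {i c : M} (h : InFin i c) : i < c := by
  obtain ⟨k, m, n, rfl, hi, -⟩ := h
  exact hi.trans_le (left_le_pair _ _)

theorem le_of_eq_triple {c k m n : M} (h : c = pair k (pair m n)) : k ≤ c ∧ m ≤ c ∧ n ≤ c := by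
  subst h
  exact ⟨left_le_pair _ _, (left_le_pair _ _).trans (right_le_pair _ _),
    (right_le_pair _ _).trans (right_le_pair _ _)⟩

theorem isBdd_inFin : IsBdd M (fun γ : M × M × PUnit.{u + 1} => InFin γ.1 γ.2.1) :=
  (inferInstance : IsBdd M fun γ : M × M × PUnit.{u + 1} =>
    ∃ k, k ≤ γ.2.1 ∧ ∃ m, m ≤ γ.2.1 ∧ ∃ n, n ≤ γ.2.1 ∧
      (γ.2.1 = pair k (pair m n) ∧ γ.1 < k ∧ m * (γ.1 + 1) + 1 ∣ n)).congr fun γ => by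
    constructor
    · rintro ⟨k, m, n, h, hi, q, hq⟩
      obtain ⟨h1, h2, h3⟩ := le_of_eq_triple h
      exact ⟨k, h1, m, h2, n, h3, h, hi, q, hq.symm⟩
    · rintro ⟨k, -, m, -, n, -, h, hi, q, hq⟩
      exact ⟨k, m, n, h, hi, q, hq.symm⟩

instance IsBdd.inFin (s t : Γ → M) [IsTerm M s] [IsTerm M t] :
    IsBdd M (fun γ => InFin (s γ) (t γ)) :=
  isBdd_inFin.comp₂ s t

theorem isBdd_isTriple : IsBdd M (fun γ : M × PUnit.{u + 1} => IsTriple γ.1) :=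
  (inferInstance : IsBdd M fun γ : M × PUnit.{u + 1} =>
    ∃ k, k ≤ γ.1 ∧ ∃ m, m ≤ γ.1 ∧ ∃ n, n ≤ γ.1 ∧ γ.1 = pair k (pair m n)).congr fun γ => by
    constructor
    · rintro ⟨k, m, n, h⟩
      obtain ⟨h1, h2, h3⟩ := le_of_eq_triple h
      exact ⟨k, h1, m, h2, n, h3, h⟩
    · rintro ⟨k, -, m, -, n, -, h⟩
      exact ⟨k, m, n, h⟩

instance IsBdd.isTriple (t : Γ → M) [IsTerm M t] : IsBdd M (fun γ => IsTriple (t γ)) :=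
  isBdd_isTriple.comp₁ t

/-- Elements of a finite set lie below its code, so sets coded by `d < c` and by `c` need only be
compared below `c`. -/
theorem isBdd_isFinCode : IsBdd M (fun γ : M × PUnit.{u + 1} => IsFinCode γ.1) :=
  (inferInstance : IsBdd M fun γ : M × PUnit.{u + 1} =>
    IsTriple γ.1 ∧ ∀ d, d < γ.1 → IsTriple d → ¬ ∀ i, i < γ.1 → (InFin i d ↔ InFin i γ.1)).congr
    fun γ => by
      unfold IsFinCode
      refine and_congr_right fun _ => forall₃_congr fun d hd _ => not_congr ?_
      exact ⟨fun h i _ => h i, fun h i => ⟨fun h' => (h i (h'.lt.trans hd)).1 h',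
        fun h' => (h i h'.lt).2 h'⟩⟩

instance IsBdd.isFinCode (t : Γ → M) [IsTerm M t] : IsBdd M (fun γ => IsFinCode (t γ)) :=
  isBdd_isFinCode.comp₁ t

/-! ### Coprime moduli for coding finite sets. -/

theorem exists_common_multiple (m c k : M) (h : ∀ j, j < k → m * (j + 1) + c ≠ 0) :
    ∃ n, n ≠ 0 ∧ ∀ j, j < k → m * (j + 1) + c ∣ n := by
  have key : ∀ l : M, ¬ l ≤ k ∨ ∃ n, n ≠ (0 : M) ∧ ∀ j, j < l → m * (j + 1) + c ∣ n := by
    refine sig_induction inferInstance (.inr ⟨1, one_ne_zero, fun j hj => (hM.out.not_lt_zero j hj).elim⟩)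
      fun l ih => ?_
    by_cases hl : l + 1 ≤ k
    · right
      obtain ⟨n, hn, hd⟩ := ih.resolve_left (not_not_intro (le_self_add.trans hl))
      refine ⟨n * (m * (l + 1) + c), mul_ne_zero hn (h l (add_one_le_iff_lt.1 hl)),
        fun j hj => ?_⟩
      rcases (lt_add_one_iff_le.1 hj).lt_or_eq with h' | rfl
      · exact (hd j h').mul_right _
      · exact dvd_mul_left _ _
    · exact .inl hl
  exact (key k).resolve_left (not_not_intro le_rfl)

theorem dvd_of_dvd_add {a x y : M} (h : a ∣ x) (h' : a ∣ x + y) : a ∣ y := by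
  obtain ⟨u, rfl⟩ := h
  obtain ⟨v, hv⟩ := h'
  rcases le_total u v with h | h
  · obtain ⟨w, rfl⟩ := exists_add_of_le h
    exact ⟨w, add_left_cancel (a := a * u) (by rw [hv]; ring)⟩
  · have h1 : a * u + y ≤ a * u := hv.trans_le (by gcongr)
    have : y = 0 := by simpa using h1
    simp [this]

/-- The moduli `a = m (i + 1) + 1` and `b = m (j + 1) + 1` are coprime when `j - i` divides `m`: an
explicit Bézout identity replaces primes and gcds. -/
theorem dvd_cancel_of_sub_dvd {m i j n : M} (hm : ∃ l, j = i + l + 1 ∧ l + 1 ∣ m) :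
    (m * (i + 1) + 1 ∣ (m * (j + 1) + 1) * n → m * (i + 1) + 1 ∣ n) ∧
      (m * (j + 1) + 1 ∣ (m * (i + 1) + 1) * n → m * (j + 1) + 1 ∣ n) := by
  obtain ⟨l, hj, t, ht⟩ := hm
  -- The two products differ by `t (j - i) = m`. Modulo `a` the number `m (i + 1)` is `-1`, so
  -- multiplying by `i + 1` expresses 1 through `a` and `b`; likewise with `j + 1` modulo `b`. All
  -- terms are kept positive.
  have e : t * (j + 1) * (m * (i + 1) + 1) = t * (i + 1) * (m * (j + 1) + 1) + m := by
    rw [hj]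
    nth_rewrite 3 [ht]
    ring
  set a := m * (i + 1) + 1 with ha
  set b := m * (j + 1) + 1 with hb
  constructor
  · intro hd
    have e1 : (i + 1) * (t * (j + 1)) * n * a + n = (i + 1) * (t * (i + 1)) * (b * n) + a * n := by
      calc _ = (i + 1) * n * (t * (j + 1) * a) + n := by ring
        _ = _ := by rw [e, ha]; ring
    exact dvd_of_dvd_add (dvd_mul_left _ _) (e1 ▸ dvd_add (hd.mul_left _) (dvd_mul_right _ _))
  · intro hd
    have e1 : (j + 1) * (t * (i + 1)) * n * b + (b * n) = (j + 1) * (t * (j + 1)) * (a * n) + n := by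
      calc _ = (j + 1) * n * (t * (i + 1) * b + m) + n := by rw [hb]; ring
        _ = _ := by rw [← e]; ring
    exact dvd_of_dvd_add (hd.mul_left _) (e1 ▸ dvd_add (dvd_mul_left _ _) (dvd_mul_right _ _))

/-- The data needed to code all subsets of `{i : i < k}` by numbers below `pair k (pair m N)`. -/
def IsModulus (k m N : M) : Prop :=
  m ≠ 0 ∧ N ≠ 0 ∧ (∀ j, j < k → j + 1 ∣ m) ∧ ∀ j, j < k → m * (j + 1) + 1 ∣ N

instance IsBdd.isModulus (r s t : Γ → M) [IsTerm M r] [IsTerm M s] [IsTerm M t] :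
    IsBdd M (fun γ => IsModulus (r γ) (s γ) (t γ)) :=
  IsBdd.comp₃ (P := IsModulus) (by unfold IsModulus; infer_instance) r s t

theorem exists_isModulus (k : M) : ∃ m N, IsModulus k m N := by
  -- The first call gives a multiple of `1, …, k`, which contains all differences of indices; the
  -- second gives a multiple of all moduli.
  obtain ⟨m, hm, hd⟩ := exists_common_multiple 1 0 k (fun j _ => by simp)
  obtain ⟨N, hN, hd'⟩ := exists_common_multiple m 1 k (fun j _ => by simp)
  exact ⟨m, N, hm, hN, by simpa using hd, hd'⟩

theorem IsModulus.dvd_cancel {k m N i j n : M} (h : IsModulus k m N) (hi : i < k) (hj : j < k)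
    (hij : i ≠ j) (hd : m * (i + 1) + 1 ∣ (m * (j + 1) + 1) * n) : m * (i + 1) + 1 ∣ n := by
  rcases lt_or_gt_of_ne hij with h' | h'
  · obtain ⟨l, hl⟩ := lt_iff_exists_add_one.1 h'
    refine (dvd_cancel_of_sub_dvd ⟨l, hl, h.2.2.1 l (lt_of_le_of_lt ?_ hj)⟩).1 hd
    rw [hl, _root_.add_assoc, _root_.add_comm i]
    exact (le_self_add (a := l) (b := 1)).trans le_self_add
  · obtain ⟨l, hl⟩ := lt_iff_exists_add_one.1 h'
    refine (dvd_cancel_of_sub_dvd ⟨l, hl, h.2.2.1 l (lt_of_le_of_lt ?_ hi)⟩).2 hd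
    rw [hl, _root_.add_assoc, _root_.add_comm j]
    exact (le_self_add (a := l) (b := 1)).trans le_self_add

theorem IsModulus.exists_inFin {k m N : M} (h : IsModulus k m N) {X : Set M}
    (hX : X ∈ sets (M := M)) : ∃ n, n ≤ N ∧ ∀ i, i < k → (m * (i + 1) + 1 ∣ n ↔ i ∈ X) := by
  have : Fact (X ∈ sets (M := M)) := ⟨hX⟩
  -- Here `n` is the product of the moduli of the `i < l` in `X`, and the cofactor `r` is still
  -- divisible by every modulus from `l` on. Since `n * r = N`, both are at most `N`: the induction
  -- predicate is Σ⁰₀ and the bound on `n` does not depend on `X`.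
  have key : ∀ l : M, l ≤ k → ∃ n, n ≤ N ∧ ∃ r, r ≤ N ∧ (n * r = N ∧
      (∀ i, i < k → (m * (i + 1) + 1 ∣ n ↔ i < l ∧ i ∈ X)) ∧
      ∀ i, i < k → l ≤ i → m * (i + 1) + 1 ∣ r) := by
    refine sig_induction inferInstance ?_ fun l ih hl => ?_
    · refine fun _ => ⟨1, by simpa using add_one_le_iff_lt.2 (pos_iff_ne_zero.2 h.2.1), N, le_rfl,
        by simp, fun i _ => ?_, fun i hi _ => h.2.2.2 i hi⟩
      simp only [hM.out.not_lt_zero i, false_and, iff_false]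
      rintro ⟨q, hq⟩
      have hm := pos_iff_ne_zero.2 h.1
      have hq0 : 0 < q := by
        rw [pos_iff_ne_zero]
        rintro rfl
        simp at hq
      have : (1 : M) < (m * (i + 1) + 1) * q := by
        calc (1 : M) < m * (i + 1) + 1 := by
              rw [lt_add_iff_pos_left]
              positivity
          _ ≤ _ := le_mul_of_one_le_right zero_le (by simpa using add_one_le_iff_lt.2 hq0)
      exact this.ne hq
    · have hlk : l < k := add_one_le_iff_lt.1 hl
      obtain ⟨n, hn, r, hr, hnr, h1, h2⟩ := ih hlk.le
      by_cases hlX : l ∈ X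
      -- The modulus of `l` moves from `r` to `n`; coprimality leaves divisibility by the other
      -- moduli unaffected.
      · obtain ⟨r', hr'⟩ := h2 l hlk le_rfl
        have e : n * (m * (l + 1) + 1) * r' = N := by rw [← hnr, hr']; ring
        have hne : n * (m * (l + 1) + 1) ≠ 0 ∧ r' ≠ 0 := by
          constructor <;> intro h0 <;> rw [h0] at e <;> simp at e <;> exact h.2.1 e.symm
        refine ⟨n * (m * (l + 1) + 1), ?_, r', ?_, e, fun i hi => ?_, fun i hi hli => ?_⟩
        · rw [← e]
          exact le_mul_of_one_le_right zero_le
            (by simpa using add_one_le_iff_lt.2 (pos_iff_ne_zero.2 hne.2))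
        · rw [← e]
          exact le_mul_of_one_le_left zero_le
            (by simpa using add_one_le_iff_lt.2 (pos_iff_ne_zero.2 hne.1))
        · rw [lt_add_one_iff_le]
          by_cases hil : i = l
          · subst hil
            simp [hlX]
          · rw [le_iff_lt_or_eq, or_iff_left hil, ← h1 i hi]
            refine ⟨fun hd => h.dvd_cancel hi hlk hil ?_, fun hd => hd.mul_right _⟩
            rwa [_root_.mul_comm n] at hd
        · have hli' := add_one_le_iff_lt.1 hli
          refine h.dvd_cancel hi hlk hli'.ne' ?_
          rw [← hr']
          exact h2 i hi hli'.le
      · refine ⟨n, hn, r, hr, hnr, fun i hi => ?_, fun i hi hli => h2 i hi (le_self_add.trans hli)⟩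
        rw [h1 i hi, lt_add_one_iff_le, le_iff_lt_or_eq]
        constructor
        · exact fun ⟨a, b⟩ => ⟨.inl a, b⟩
        · rintro ⟨a | rfl, b⟩
          · exact ⟨a, b⟩
          · exact (hlX b).elim
  obtain ⟨n, hn, -, -, -, h1, -⟩ := key k le_rfl
  exact ⟨n, hn, fun i hi => by simp [h1 i hi, hi]⟩

/-- Every subset of `{i : i < k}` is represented by a triple `≤ b`. -/
def IsCodeBound (k b : M) : Prop := ∃ m N, b = pair k (pair m N) ∧ IsModulus k m N

theorem isBdd_isCodeBound : IsBdd M (fun γ : M × M × PUnit.{u + 1} => IsCodeBound γ.1 γ.2.1) :=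
  (inferInstance : IsBdd M fun γ : M × M × PUnit.{u + 1} =>
    ∃ m, m ≤ γ.2.1 ∧ ∃ N, N ≤ γ.2.1 ∧ (γ.2.1 = pair γ.1 (pair m N) ∧ IsModulus γ.1 m N)).congr
    fun γ => by
      constructor
      · rintro ⟨m, n, h, h'⟩
        obtain ⟨-, h2, h3⟩ := le_of_eq_triple h
        exact ⟨m, h2, n, h3, h, h'⟩
      · rintro ⟨m, -, n, -, h, h'⟩
        exact ⟨m, n, h, h'⟩

instance IsBdd.isCodeBound (s t : Γ → M) [IsTerm M s] [IsTerm M t] :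
    IsBdd M (fun γ => IsCodeBound (s γ) (t γ)) :=
  isBdd_isCodeBound.comp₂ s t

theorem exists_isCodeBound (k : M) : ∃ b, IsCodeBound k b := by
  obtain ⟨m, N, h⟩ := exists_isModulus k
  exact ⟨_, m, N, rfl, h⟩

theorem IsCodeBound.exists_triple {k b : M} (h : IsCodeBound k b) {X : Set M}
    (hX : X ∈ sets (M := M)) :
    ∃ c, c ≤ b ∧ IsTriple c ∧ ∀ i, InFin i c ↔ i < k ∧ i ∈ X := by
  obtain ⟨m, N, rfl, h⟩ := h
  obtain ⟨n, hn, hX⟩ := h.exists_inFin hX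
  refine ⟨pair k (pair m n), pair_mono le_rfl (pair_mono le_rfl hn), ⟨_, _, _, rfl⟩, fun i => ?_⟩
  rw [inFin_pair]
  exact and_congr_right fun hi => hX i hi

theorem exists_isFinCode (k : M) {X : Set M} (hX : X ∈ sets (M := M)) :
    ∃ c, IsFinCode c ∧ ∀ i, InFin i c ↔ i < k ∧ i ∈ X := by
  have : Fact (X ∈ sets (M := M)) := ⟨hX⟩
  obtain ⟨b, hb⟩ := exists_isCodeBound k
  obtain ⟨c, -, hc, hc'⟩ := hb.exists_triple hX
  -- Restricting to `i < d + k` keeps the predicate Σ⁰₀ and loses nothing: elements of the set coded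
  -- by `d` are below `d`, those of the target below `k`.
  obtain ⟨d, -, ⟨hd, hd'⟩, hmin⟩ := exists_least
    (P := fun d => IsTriple d ∧ ∀ i, i < d + k → (InFin i d ↔ i < k ∧ i ∈ X)) inferInstance
    ⟨hc, fun i _ => hc' i⟩
  have hd'' : ∀ i, InFin i d ↔ i < k ∧ i ∈ X := fun i =>
    ⟨fun h => (hd' i (h.lt.trans_le le_self_add)).1 h,
      fun h => (hd' i (h.1.trans_le le_add_self)).2 h⟩
  refine ⟨d, ⟨hd, fun e he het h => hmin e he ⟨het, fun i _ => ?_⟩⟩, hd''⟩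
  rw [h, hd'']

theorem IsFinCode.le_bound {k b c : M} (hb : IsCodeBound k b) (hc : IsFinCode c)
    (h : ∀ i, InFin i c → i < k) : c ≤ b := by
  obtain ⟨X, hX, hX'⟩ := exists_set_of_isBdd (fun i : M => InFin i c)
  obtain ⟨d, hd, hdt, hd'⟩ := hb.exists_triple hX
  by_contra hlt
  refine hc.2 d (hd.trans_lt (not_le.1 hlt)) hdt fun i => ?_
  rw [hd', hX']
  exact ⟨fun h => h.2, fun h' => ⟨h i h', h'⟩⟩

theorem IsFinCode.ext {c d : M} (hc : IsFinCode c) (hd : IsFinCode d)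
    (h : ∀ i, InFin i c ↔ InFin i d) : c = d := by
  rcases lt_trichotomy c d with h' | h' | h'
  · exact (hd.2 c h' hc.1 h).elim
  · exact h'
  · exact (hc.2 d h' hd.1 fun i => (h i).symm).elim

end

section

variable {M : Type u} [L2Structure M] [hM : Fact (ModelsRCA0 M)] {Γ : Type u} [Ctx M Γ]

/-! ### Codes of finite binary sequences -/

theorem InFin.left_lt {j k σ : M} (h : InFin (pair j k) σ) : j < σ :=
  (left_le_pair j k).trans_lt h.lt

theorem InFin.right_lt {j k σ : M} (h : InFin (pair j k) σ) : k < σ :=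
  (right_le_pair j k).trans_lt h.lt

theorem isBdd_isSeqLen : IsBdd M (fun γ : M × M × PUnit.{u + 1} => IsSeqLen γ.1 γ.2.1) :=
  (inferInstance : IsBdd M fun γ : M × M × PUnit.{u + 1} =>
    IsFinCode γ.1 ∧
    (∀ i, i < γ.1 → InFin i γ.1 → ∃ j, j ≤ i ∧ ∃ k, k ≤ i ∧ i = pair j k) ∧
    (∀ j, j < γ.1 → ∀ k, k < γ.1 → ∀ k', k' < γ.1 →
      InFin (pair j k) γ.1 → InFin (pair j k') γ.1 → k = k') ∧
    ∀ j, j < γ.1 + γ.2.1 → (j < γ.2.1 ↔ ∃ k, k < γ.1 ∧ InFin (pair j k) γ.1)).congr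
    fun γ => by
      refine and_congr_right fun _ => and_congr ?_ (and_congr ?_ ?_)
      · constructor
        · intro h i _ hi
          obtain ⟨j, k, rfl⟩ := h i hi
          exact ⟨j, left_le_pair _ _, k, right_le_pair _ _, rfl⟩
        · intro h i hi
          obtain ⟨j, -, k, -, e⟩ := h i hi.lt hi
          exact ⟨j, k, e⟩
      · exact ⟨fun h j _ k _ k' _ => h j k k',
          fun h j k k' h1 h2 => h j h1.left_lt k h1.right_lt k' h2.right_lt h1 h2⟩
      · constructor
        · intro h j _
          rw [h]
          exact ⟨fun ⟨k, hk⟩ => ⟨k, hk.right_lt, hk⟩, fun ⟨k, _, hk⟩ => ⟨k, hk⟩⟩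
        · intro h j
          constructor
          · intro hj
            obtain ⟨k, -, hk⟩ := (h j (hj.trans_le le_add_self)).1 hj
            exact ⟨k, hk⟩
          · rintro ⟨k, hk⟩
            exact (h j (hk.left_lt.trans_le le_self_add)).2 ⟨k, hk.right_lt, hk⟩

instance IsBdd.isSeqLen (s t : Γ → M) [IsTerm M s] [IsTerm M t] :
    IsBdd M (fun γ => IsSeqLen (s γ) (t γ)) :=
  isBdd_isSeqLen.comp₂ s t

theorem IsSeqLen.length_le {σ l : M} (h : IsSeqLen σ l) : l ≤ σ := by
  by_contra hlt
  obtain ⟨k, hk⟩ := (h.2.2.2 σ).1 (not_le.1 hlt)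
  exact hk.left_lt.false

theorem IsSeqLen.length_unique {σ l l' : M} (h : IsSeqLen σ l) (h' : IsSeqLen σ l') : l = l' :=
  eq_of_forall_lt_iff fun j => (h.2.2.2 j).trans (h'.2.2.2 j).symm

/-- `σ` codes a sequence of zeros and ones of length `l`. -/
def IsBinSeqLen (σ l : M) : Prop :=
  IsSeqLen σ l ∧ ∀ j k : M, InFin (pair j k) σ → k = 0 ∨ k = 1

theorem isBdd_isBinSeqLen : IsBdd M (fun γ : M × M × PUnit.{u + 1} => IsBinSeqLen γ.1 γ.2.1) :=
  (inferInstance : IsBdd M fun γ : M × M × PUnit.{u + 1} => IsSeqLen γ.1 γ.2.1 ∧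
    ∀ j, j < γ.1 → ∀ k, k < γ.1 → InFin (pair j k) γ.1 → k = 0 ∨ k = 1).congr fun _ =>
    and_congr_right fun _ => ⟨fun h j _ k _ => h j k, fun h j k h1 => h j h1.left_lt k h1.right_lt h1⟩

instance IsBdd.isBinSeqLen (s t : Γ → M) [IsTerm M s] [IsTerm M t] :
    IsBdd M (fun γ => IsBinSeqLen (s γ) (t γ)) :=
  isBdd_isBinSeqLen.comp₂ s t

theorem IsBinSeqLen.isBinSeq {σ l : M} (h : IsBinSeqLen σ l) : IsBinSeq σ := ⟨⟨l, h.1⟩, h.2⟩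

theorem IsBinSeq.exists_length {σ : M} (h : IsBinSeq σ) : ∃ l, IsBinSeqLen σ l := by
  obtain ⟨⟨l, hl⟩, h⟩ := h
  exact ⟨l, hl, h⟩

/-- A binary sequence is determined by its length and the positions of its ones, so only `pair j 1`
needs to be tracked later. -/
theorem IsBinSeqLen.inFin_iff {σ l i : M} (h : IsBinSeqLen σ l) :
    InFin i σ ↔ ∃ j, j < l ∧
      (i = pair j 1 ∧ InFin (pair j 1) σ ∨ i = pair j 0 ∧ ¬ InFin (pair j 1) σ) := by
  constructor
  · intro hi
    obtain ⟨j, k, rfl⟩ := h.1.2.1 i hi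
    refine ⟨j, (h.1.2.2.2 j).2 ⟨k, hi⟩, ?_⟩
    rcases h.2 j k hi with rfl | rfl
    · exact .inr ⟨rfl, fun h1 => zero_ne_one (h.1.2.2.1 j _ _ hi h1)⟩
    · exact .inl ⟨rfl, hi⟩
  · rintro ⟨j, hj, ⟨rfl, h1⟩ | ⟨rfl, h1⟩⟩
    · exact h1
    · obtain ⟨k, hk⟩ := (h.1.2.2.2 j).1 hj
      rcases h.2 j k hk with rfl | rfl
      · exact hk
      · exact (h1 hk).elim

theorem IsBinSeqLen.lt_of_inFin {σ l j k : M} (h : IsBinSeqLen σ l) (hj : InFin (pair j k) σ) :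
    j < l :=
  (h.1.2.2.2 j).2 ⟨k, hj⟩

theorem exists_isBinSeqLen (n : M) {X : Set M} (hX : X ∈ sets (M := M)) :
    ∃ σ, IsBinSeqLen σ n ∧ ∀ j, InFin (pair j 1) σ ↔ j < n ∧ j ∈ X := by
  have : Fact (X ∈ sets (M := M)) := ⟨hX⟩
  obtain ⟨Y, hY, hY'⟩ := exists_set_of_isBdd
    (fun i : M => ∃ j, j < n ∧ (i = pair j 1 ∧ j ∈ X ∨ i = pair j 0 ∧ ¬ j ∈ X))
  -- Monotonicity of pairing puts all pairs `(j, 0)` and `(j, 1)` with `j < n` below `pair n 1 + 1`.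
  obtain ⟨σ, hσ, hσY⟩ := exists_isFinCode (pair n 1 + 1) hY
  have key : ∀ i, InFin i σ ↔ ∃ j, j < n ∧ (i = pair j 1 ∧ j ∈ X ∨ i = pair j 0 ∧ ¬ j ∈ X) := by
    intro i
    rw [hσY, hY', and_iff_right_iff_imp]
    rintro ⟨j, hj, ⟨rfl, -⟩ | ⟨rfl, -⟩⟩
    · exact lt_add_one_iff_le.2 (pair_mono hj.le le_rfl)
    · exact lt_add_one_iff_le.2 (pair_mono hj.le zero_le)
  have key' : ∀ j k, InFin (pair j k) σ ↔ j < n ∧ (k = 1 ∧ j ∈ X ∨ k = 0 ∧ ¬ j ∈ X) := by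
    intro j k
    rw [key]
    simp only [pair_inj]
    constructor
    · rintro ⟨j, hj, ⟨⟨rfl, rfl⟩, h⟩ | ⟨⟨rfl, rfl⟩, h⟩⟩
      · exact ⟨hj, .inl ⟨rfl, h⟩⟩
      · exact ⟨hj, .inr ⟨rfl, h⟩⟩
    · rintro ⟨hj, ⟨rfl, h⟩ | ⟨rfl, h⟩⟩
      · exact ⟨j, hj, .inl ⟨⟨rfl, rfl⟩, h⟩⟩
      · exact ⟨j, hj, .inr ⟨⟨rfl, rfl⟩, h⟩⟩
  refine ⟨σ, ⟨⟨hσ, fun i hi => ?_, fun j k k' h h' => ?_, fun j => ?_⟩, fun j k h => ?_⟩,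
    fun j => ?_⟩
  · obtain ⟨j, -, ⟨h, -⟩ | ⟨h, -⟩⟩ := (key i).1 hi
    · exact ⟨_, _, h⟩
    · exact ⟨_, _, h⟩
  · rw [key'] at h h'
    rcases h.2 with ⟨h1, h2⟩ | ⟨h1, h2⟩ <;> rcases h'.2 with ⟨h3, h4⟩ | ⟨h3, h4⟩
    · rw [h1, h3]
    · exact (h4 h2).elim
    · exact (h2 h4).elim
    · rw [h1, h3]
  · simp only [key']
    constructor
    · intro hj
      by_cases h : j ∈ X
      · exact ⟨1, hj, .inl ⟨rfl, h⟩⟩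
      · exact ⟨0, hj, .inr ⟨rfl, h⟩⟩
    · rintro ⟨k, hk, -⟩
      exact hk
  · rw [key'] at h
    rcases h.2 with ⟨h, -⟩ | ⟨h, -⟩
    · exact .inr h
    · exact .inl h
  · simp [key']

theorem IsBinSeqLen.isInitSeg {σ τ n l : M} (hσ : IsBinSeqLen σ n) (hτ : IsBinSeqLen τ l)
    (h : n ≤ l) (hb : ∀ j, j < n → (InFin (pair j 1) σ ↔ InFin (pair j 1) τ)) :
    IsInitSeg σ τ := by
  refine ⟨⟨n, hσ.1⟩, ⟨l, hτ.1⟩, fun i hi => ?_⟩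
  rw [hσ.inFin_iff] at hi
  obtain ⟨j, hj, hi⟩ := hi
  rw [hτ.inFin_iff]
  refine ⟨j, hj.trans_le h, ?_⟩
  rwa [← hb j hj]

theorem IsInitSeg.isBinSeqLen {σ τ l : M} (h : IsInitSeg σ τ) (hτ : IsBinSeqLen τ l) :
    ∃ n, n ≤ l ∧ IsBinSeqLen σ n ∧ ∀ j, j < n → (InFin (pair j 1) σ ↔ InFin (pair j 1) τ) := by
  obtain ⟨⟨n, hn⟩, -, h⟩ := h
  refine ⟨n, le_of_forall_lt fun j hj => ?_, ⟨hn, fun j k hk => hτ.2 j k (h _ hk)⟩, fun j hj =>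
    ⟨fun h' => h _ h', fun h' => ?_⟩⟩
  · obtain ⟨k, hk⟩ := (hn.2.2.2 j).1 hj
    exact hτ.lt_of_inFin (h _ hk)
  · obtain ⟨k, hk⟩ := (hn.2.2.2 j).1 hj
    rwa [hτ.1.2.2.1 j _ _ h' (h _ hk)]

theorem IsBinSeqLen.le_bound {σ l n b : M} (hσ : IsBinSeqLen σ l) (h : l ≤ n)
    (hb : IsCodeBound (pair n 1 + 1) b) : σ ≤ b := by
  refine hσ.1.1.le_bound hb fun i hi => ?_
  rw [hσ.inFin_iff] at hi
  rw [lt_add_one_iff_le]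
  obtain ⟨j, hj, ⟨rfl, -⟩ | ⟨rfl, -⟩⟩ := hi
  · exact pair_mono (hj.le.trans h) le_rfl
  · exact pair_mono (hj.le.trans h) zero_le

theorem IsBinSeqLen.ext {σ τ l : M} (hσ : IsBinSeqLen σ l) (hτ : IsBinSeqLen τ l)
    (h : ∀ j, j < l → (InFin (pair j 1) σ ↔ InFin (pair j 1) τ)) : σ = τ :=
  hσ.1.1.ext hτ.1.1 fun i =>
    ⟨(hσ.isInitSeg hτ le_rfl h).2.2 i, (hτ.isInitSeg hσ le_rfl fun j hj => (h j hj).symm).2.2 i⟩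

end

section

variable {M : Type u} [L2Structure M] [hM : Fact (ModelsRCA0 M)] {Γ : Type u} [Ctx M Γ]

/-! ### Initial interval separation from weak König's lemma -/

/-- Comprehension for the Σ⁰₀ matrix replaces the formula by a set of pairs of witness and argument.
-/
theorem IsSigma01.exists_set {φ : M → Prop} (h : IsSigma01 φ) :
    ∃ S ∈ sets (M := M), ∀ x, φ x ↔ ∃ m, pair m x ∈ S := by
  obtain ⟨θ, hθ, e⟩ := (isSigma01_iff.1 h).out
  have (Δ : Type u) [Ctx M Δ] (s t : Δ → M) [IsTerm M s] [IsTerm M t] :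
      IsBdd M (fun δ => θ (s δ, t δ, PUnit.unit)) :=
    IsBdd.comp (fun δ => (s δ, t δ, PUnit.unit)) θ
  obtain ⟨S, hS, h⟩ := exists_set_of_isBdd
    (fun i : M => ∃ m, m ≤ i ∧ ∃ x, x ≤ i ∧ i = pair m x ∧ θ (m, x, PUnit.unit))
  refine ⟨S, hS, fun x => (e (x, PUnit.unit)).trans (exists_congr fun m => ?_)⟩
  rw [h]
  constructor
  · exact fun hθ => ⟨m, left_le_pair _ _, x, right_le_pair _ _, rfl, hθ⟩
  · rintro ⟨m', -, x', -, h, hθ⟩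
    obtain ⟨rfl, rfl⟩ := pair_inj.1 h
    exact hθ

theorem isInfiniteIn_of_forall_exists {T : Set M}
    (h : ∀ n, ∃ σ ∈ T, IsBinSeqLen σ n) : IsInfiniteIn T := by
  rintro ⟨k, hk⟩
  obtain ⟨σ, hσ, hl⟩ := h k
  exact (hl.1.length_le.trans_lt (hk σ hσ)).false

/-- The binary sequence `σ` of length `l` approximates an initial interval that contains the `x ∈ P`
with `pair m x ∈ S` and avoids those with `pair m x ∈ S'`, for some `m < l`. -/
def IsApprox (P R S S' : Set M) (σ l : M) : Prop :=
  IsBinSeqLen σ l ∧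
    (∀ x, x < l → ∀ y, y < l → pair x y ∈ R → InFin (pair y 1) σ → InFin (pair x 1) σ) ∧
    (∀ x, x < l → x ∈ P → (∃ m, m < l ∧ pair m x ∈ S) → InFin (pair x 1) σ) ∧
    ∀ x, x < l → x ∈ P → (∃ m, m < l ∧ pair m x ∈ S') → ¬ InFin (pair x 1) σ

instance IsBdd.isApprox (P R S S' : Set M) [Fact (P ∈ sets (M := M))] [Fact (R ∈ sets (M := M))]
    [Fact (S ∈ sets (M := M))] [Fact (S' ∈ sets (M := M))] (s t : Γ → M) [IsTerm M s]
    [IsTerm M t] : IsBdd M (fun γ => IsApprox P R S S' (s γ) (t γ)) :=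
  IsBdd.comp₂ (P := IsApprox P R S S') (by unfold IsApprox; infer_instance) s t

/-- The bounds on points and on witnesses both shrink with the length, so every condition passes to
initial segments. -/
theorem IsApprox.of_isInitSeg {P R S S' : Set M} {σ τ l : M} (h : IsApprox P R S S' τ l)
    (hστ : IsInitSeg σ τ) : ∃ n, IsApprox P R S S' σ n := by
  obtain ⟨n, hn, hσ, hb⟩ := hστ.isBinSeqLen h.1
  refine ⟨n, hσ, fun x hx y hy hR => ?_, fun x hx hP => ?_, fun x hx hP => ?_⟩
  · rw [hb x hx, hb y hy]
    exact h.2.1 x (hx.trans_le hn) y (hy.trans_le hn) hR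
  · rintro ⟨m, hm, hS⟩
    rw [hb x hx]
    exact h.2.2.1 x (hx.trans_le hn) hP ⟨m, hm.trans_le hn, hS⟩
  · rintro ⟨m, hm, hS⟩
    rw [hb x hx]
    exact h.2.2.2 x (hx.trans_le hn) hP ⟨m, hm.trans_le hn, hS⟩

theorem exists_isApprox {P R S S' : Set M} (hP : P ∈ sets (M := M)) (hR : R ∈ sets (M := M))
    (hS : S ∈ sets (M := M)) (hPR : IsPartialOrderOn P R)
    (h : ∀ x ∈ P, ∀ y ∈ P, (∃ m, pair m x ∈ S) ∧ (∃ m, pair m y ∈ S') → pair y x ∉ R) (n : M) :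
    ∃ σ, IsApprox P R S S' σ n := by
  have : Fact (P ∈ sets (M := M)) := ⟨hP⟩
  have : Fact (R ∈ sets (M := M)) := ⟨hR⟩
  have : Fact (S ∈ sets (M := M)) := ⟨hS⟩
  -- The downward closure of the points with an `S`-witness, cut off at `n`. It avoids the points
  -- with an `S'`-witness by `h`.
  obtain ⟨X, hX, hX'⟩ := exists_set_of_isBdd
    (fun x : M => ∃ y, y < n ∧ (y ∈ P ∧ pair x y ∈ R ∧ ∃ m, m < n ∧ pair m y ∈ S))
  obtain ⟨σ, hσ, hb⟩ := exists_isBinSeqLen n hX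
  have hmem {x y : M} (h : pair x y ∈ R) : x ∈ P ∧ y ∈ P := by
    obtain ⟨x', hx', y', hy', e⟩ := hPR.subset _ h
    obtain ⟨rfl, rfl⟩ := pair_inj.1 e
    exact ⟨hx', hy'⟩
  refine ⟨σ, hσ, fun x hx y hy hxy => ?_, fun x hx hxP => ?_, fun x hx hxP => ?_⟩
  · rw [hb, hb, hX', hX']
    rintro ⟨-, z, hz, hzP, hyz, hm⟩
    exact ⟨hx, z, hz, hzP, hPR.trans x (hmem hxy).1 y (hmem hxy).2 z hzP hxy hyz, hm⟩
  · intro hm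
    rw [hb, hX']
    exact ⟨hx, x, hx, hxP, hPR.refl x hxP, hm⟩
  · rintro ⟨m, -, hm⟩
    rw [hb, hX']
    rintro ⟨-, y, -, hyP, hxy, m', -, hm'⟩
    exact h y hyP x hxP ⟨⟨m', hm'⟩, m, hm⟩ hxy

theorem WeakKonig.sigma01InitialIntervalSeparation (hW : WeakKonig M) :
    Sigma01InitialIntervalSeparation M := by
  intro P hP R hR hPR φ ψ hφ hψ hφψ
  obtain ⟨S, hS, hφS⟩ := hφ.exists_set
  obtain ⟨S', hS', hψS⟩ := hψ.exists_set
  simp only [hφS, hψS] at hφψ ⊢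
  have : Fact (P ∈ sets (M := M)) := ⟨hP⟩
  have : Fact (R ∈ sets (M := M)) := ⟨hR⟩
  have : Fact (S ∈ sets (M := M)) := ⟨hS⟩
  have : Fact (S' ∈ sets (M := M)) := ⟨hS'⟩
  obtain ⟨T, hT, hT'⟩ := exists_set_of_isBdd
    (fun σ : M => ∃ l, l ≤ σ ∧ IsApprox P R S S' σ l)
  replace hT' (σ) : σ ∈ T ↔ ∃ l, IsApprox P R S S' σ l := by
    rw [hT']
    exact ⟨fun ⟨l, _, h⟩ => ⟨l, h⟩, fun ⟨l, h⟩ => ⟨l, h.1.1.length_le, h⟩⟩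
  obtain ⟨F, hF, hFT⟩ := hW T hT
    ⟨fun σ hσ => by
      obtain ⟨l, hl⟩ := (hT' σ).1 hσ
      exact hl.1.isBinSeq, fun σ τ hτ hστ => by
      obtain ⟨l, hl⟩ := (hT' τ).1 hτ
      exact (hT' σ).2 (hl.of_isInitSeg hστ)⟩
    (isInfiniteIn_of_forall_exists fun n => by
      obtain ⟨σ, hσ⟩ := exists_isApprox hP hR hS hPR hφψ n
      exact ⟨σ, (hT' σ).2 ⟨n, hσ⟩, hσ.1⟩)
  have path (n : M) : ∃ σ, IsApprox P R S S' σ n ∧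
      ∀ x, x < n → (InFin (pair x 1) σ ↔ pair x 1 ∈ F) := by
    obtain ⟨σ, hσ, hl, hσF⟩ := hFT.2 n
    obtain ⟨l, h⟩ := (hT' σ).1 hσ
    obtain rfl := hl.length_unique h.1.1
    refine ⟨σ, h, fun x hx => ⟨hσF _, fun hx1 => ?_⟩⟩
    -- The string has some value at `x`, and since `F` is a function that value is 1.
    obtain ⟨k, hk⟩ := (hl.2.2.2 x).1 hx
    rwa [(hFT.1.2 x).unique hx1 (hσF _ hk)]
  have : Fact (F ∈ sets (M := M)) := ⟨hF⟩
  obtain ⟨I, hI, hI'⟩ := exists_set_of_isBdd (fun x : M => x ∈ P ∧ pair x 1 ∈ F)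
  refine ⟨I, hI, ⟨fun x hx => ((hI' x).1 hx).1, fun x hx y hy hxy hyI => ?_⟩, fun x hx => ?_⟩
  -- This length exceeds both points, so closure of `σ` applies to them.
  · obtain ⟨σ, hσ, hσF⟩ := path (x + y + 1)
    have hx' : x < x + y + 1 := lt_add_one_iff_le.2 le_self_add
    have hy' : y < x + y + 1 := lt_add_one_iff_le.2 le_add_self
    rw [hI', ← hσF x hx']
    rw [hI', ← hσF y hy'] at hyI
    exact ⟨hx, hσ.2.1 x hx' y hy' hxy hyI.2⟩
  · constructor
    all_goals
      rintro ⟨m, hm⟩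
      obtain ⟨σ, hσ, hσF⟩ := path (x + m + 1)
      have hx' : x < x + m + 1 := lt_add_one_iff_le.2 le_self_add
      have hm' : m < x + m + 1 := lt_add_one_iff_le.2 le_add_self
      rw [hI', ← hσF x hx']
    · exact ⟨hx, hσ.2.2.1 x hx' hx ⟨m, hm', hm⟩⟩
    · exact fun h => hσ.2.2.2 x hx' hx ⟨m, hm', hm⟩ h.2

theorem Sigma01InitialIntervalSeparation.initialIntervalSeparation
    (h : Sigma01InitialIntervalSeparation M) : InitialIntervalSeparation M := by
  intro P hP R hR hPR A hA B hB hAP hBP hAB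
  have : Fact (A ∈ sets (M := M)) := ⟨hA⟩
  have : Fact (B ∈ sets (M := M)) := ⟨hB⟩
  obtain ⟨I, hI, hI', hs⟩ := h P hP R hR hPR (· ∈ A) (· ∈ B) (isSigma01_iff.2 inferInstance)
    (isSigma01_iff.2 inferInstance) fun x _ y _ hxy => hAB x hxy.1 y hxy.2
  refine ⟨I, hI, hI', fun x hx => (hs x (hAP hx)).1 hx, ?_⟩
  ext x
  exact ⟨fun ⟨hx, hxI⟩ => (hs x (hBP hx)).2 hx hxI, fun hx => hx.elim⟩

/-! ### Separation of disjoint `Σ⁰₁` predicates -/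

/-- Apply initial interval separation to the order in which `pair x 0` lies below `pair x (m + 1)`
if `m` witnesses `φ x`, and above it if `m` witnesses `ψ x`. -/
theorem InitialIntervalSeparation.sigma01_separation (h : InitialIntervalSeparation M)
    {φ ψ : M → Prop} (hφ : IsSigma01 φ) (hψ : IsSigma01 ψ) (hφψ : ∀ x, φ x → ¬ ψ x) :
    ∃ X ∈ sets (M := M), ∀ x, (φ x → x ∈ X) ∧ (ψ x → x ∉ X) := by
  obtain ⟨S, hS, hφS⟩ := hφ.exists_set
  obtain ⟨S', hS', hψS⟩ := hψ.exists_set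
  simp only [hφS, hψS] at hφψ ⊢
  have : Fact (S ∈ sets (M := M)) := ⟨hS⟩
  have : Fact (S' ∈ sets (M := M)) := ⟨hS'⟩
  have disj {x m m' : M} (h : pair m x ∈ S) (h' : pair m' x ∈ S') : False :=
    hφψ x ⟨m, h⟩ ⟨m', h'⟩
  obtain ⟨P, hP, hP'⟩ := exists_set_of_isBdd (fun _ : M => (0 : M) = 0)
  -- One of `u`, `v` is `pair x (m + 1)`, so `u + v` bounds `m` in both cases.
  obtain ⟨R, hR, hR'⟩ := exists_set_of_isBdd
    (fun i : M => ∃ u, u ≤ i ∧ ∃ v, v ≤ i ∧ (i = pair u v ∧ (u = v ∨ ∃ x, x ≤ u ∧ ∃ m, m ≤ u + v ∧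
    ((u = pair x 0 ∧ v = pair x (m + 1) ∧ pair m x ∈ S) ∨
      (u = pair x (m + 1) ∧ v = pair x 0 ∧ pair m x ∈ S')))))
  obtain ⟨A, hA, hA'⟩ := exists_set_of_isBdd
    (fun i : M => ∃ x, x ≤ i ∧ ∃ m, m ≤ i ∧ (i = pair x (m + 1) ∧ pair m x ∈ S))
  obtain ⟨B, hB, hB'⟩ := exists_set_of_isBdd
    (fun i : M => ∃ x, x ≤ i ∧ ∃ m, m ≤ i ∧ (i = pair x (m + 1) ∧ pair m x ∈ S'))
  have memR (u v : M) : pair u v ∈ R ↔ u = v ∨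
      (∃ x m, u = pair x 0 ∧ v = pair x (m + 1) ∧ pair m x ∈ S) ∨
      ∃ x m, u = pair x (m + 1) ∧ v = pair x 0 ∧ pair m x ∈ S' := by
    rw [hR']
    constructor
    · rintro ⟨u', -, v', -, e, h⟩
      obtain ⟨rfl, rfl⟩ := pair_inj.1 e
      rcases h with h | ⟨x, -, m, -, h | h⟩
      · exact .inl h
      · exact .inr (.inl ⟨x, m, h⟩)
      · exact .inr (.inr ⟨x, m, h⟩)
    · intro h
      refine ⟨u, left_le_pair _ _, v, right_le_pair _ _, rfl, ?_⟩
      rcases h with h | ⟨x, m, h⟩ | ⟨x, m, h⟩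
      · exact .inl h
      · refine .inr ⟨x, ?_, m, ?_, .inl h⟩
        · exact h.1 ▸ left_le_pair _ _
        · rw [h.2.1]
          exact (le_self_add.trans (right_le_pair x (m + 1))).trans le_add_self
      · refine .inr ⟨x, ?_, m, ?_, .inr h⟩
        · exact h.1 ▸ left_le_pair _ _
        · rw [h.1]
          exact (le_self_add.trans (right_le_pair x (m + 1))).trans le_self_add
  have memA (x m : M) (h : pair m x ∈ S) : pair x (m + 1) ∈ A :=
    (hA' _).2 ⟨x, left_le_pair _ _, m, le_self_add.trans (right_le_pair _ _), rfl, h⟩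
  have memB (x m : M) (h : pair m x ∈ S') : pair x (m + 1) ∈ B :=
    (hB' _).2 ⟨x, left_le_pair _ _, m, le_self_add.trans (right_le_pair _ _), rfl, h⟩
  have memP (x : M) : x ∈ P := (hP' x).2 rfl
  have pair_ne {x y m : M} : pair x 0 ≠ pair y (m + 1) := fun e =>
    hM.out.succ_ne_zero m (pair_inj.1 e).2.symm
  -- Two strict relations never compose: `pair x 0` would lie above one point and below another, so
  -- `x` would have witnesses for both predicates. Antisymmetry and transitivity follow.
  have hPR : IsPartialOrderOn P R := by
    refine ⟨fun i hi => ?_, fun x _ => (memR x x).2 (.inl rfl), fun u _ v _ => ?_,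
      fun u _ v _ w _ => ?_⟩
    · obtain ⟨u, -, v, -, h, -⟩ := (hR' i).1 hi
      exact ⟨u, memP u, v, memP v, h⟩
    · rw [memR, memR]
      rintro (h | ⟨x, m, rfl, rfl, h⟩ | ⟨x, m, rfl, rfl, h⟩)
      · exact fun _ => h
      · rintro (e | ⟨y, n, e, -, -⟩ | ⟨y, n, -, e, h'⟩)
        · exact e.symm
        · exact (pair_ne e.symm).elim
        · obtain ⟨rfl, -⟩ := pair_inj.1 e
          exact (disj h h').elim
      · rintro (e | ⟨y, n, e, -, h'⟩ | ⟨y, n, e, -, -⟩)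
        · exact e.symm
        · obtain ⟨rfl, -⟩ := pair_inj.1 e
          exact (disj h' h).elim
        · exact (pair_ne e).elim
    · rw [memR u v, memR v w]
      rintro (rfl | ⟨x, m, rfl, rfl, h⟩ | ⟨x, m, rfl, rfl, h⟩)
      · exact (memR u w).2
      · rintro (rfl | ⟨y, n, e, -, -⟩ | ⟨y, n, e, -, h'⟩)
        · exact (memR _ _).2 (.inr (.inl ⟨x, m, rfl, rfl, h⟩))
        · exact (pair_ne e.symm).elim
        · obtain ⟨rfl, -⟩ := pair_inj.1 e
          exact (disj h h').elim
      · rintro (rfl | ⟨y, n, e, -, h'⟩ | ⟨y, n, e, -, -⟩)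
        · exact (memR _ _).2 (.inr (.inr ⟨x, m, rfl, rfl, h⟩))
        · obtain ⟨rfl, -⟩ := pair_inj.1 e
          exact (disj h' h).elim
        · exact (pair_ne e).elim
  obtain ⟨I, hI, hI', hAI, hBI⟩ := h P hP R hR hPR A hA B hB (fun x _ => memP x)
    (fun x _ => memP x) fun u hu v hv huv => by
      obtain ⟨x, -, m, -, rfl, h⟩ := (hA' u).1 hu
      obtain ⟨y, -, n, -, rfl, h'⟩ := (hB' v).1 hv
      rcases (memR _ _).1 huv with e | ⟨z, k, e, -, -⟩ | ⟨z, k, -, e, -⟩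
      · obtain ⟨rfl, -⟩ := pair_inj.1 e
        exact disj h h'
      · exact pair_ne e.symm
      · exact pair_ne e.symm
  have : Fact (I ∈ sets (M := M)) := ⟨hI⟩
  obtain ⟨X, hX, hX'⟩ := exists_set_of_isBdd (fun x : M => pair x 0 ∈ I)
  refine ⟨X, hX, fun x => ⟨?_, ?_⟩⟩ <;> rintro ⟨m, hm⟩ <;> rw [hX']
  · exact hI'.2 _ (memP _) _ (memP _) ((memR _ _).2 (.inr (.inl ⟨x, m, rfl, rfl, hm⟩)))
      (hAI (memA x m hm))
  · intro hx
    have : pair x (m + 1) ∈ B ∩ I := ⟨memB x m hm, hI'.2 _ (memP _) _ (memP _)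
      ((memR _ _).2 (.inr (.inr ⟨x, m, rfl, rfl, hm⟩))) hx⟩
    rw [hBI] at this
    exact this

end

section

variable {M : Type u} [L2Structure M] [hM : Fact (ModelsRCA0 M)] {Γ : Type u} [Ctx M Γ]

/-! ### Weak König's lemma from separation -/

/-- The sets coded by `c` and `d` agree below `l`. -/
def Agree (l c d : M) : Prop := ∀ j, j < l → (InFin j c ↔ InFin j d)

instance IsBdd.agree (r s t : Γ → M) [IsTerm M r] [IsTerm M s] [IsTerm M t] :
    IsBdd M (fun γ => Agree (r γ) (s γ) (t γ)) :=
  IsBdd.comp₃ (P := Agree) (by unfold Agree; infer_instance) r s t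

theorem Agree.refl (l c : M) : Agree l c c := fun _ _ => Iff.rfl

theorem Agree.symm {l c d : M} (h : Agree l c d) : Agree l d c := fun j hj => (h j hj).symm

theorem Agree.trans {l c d e : M} (h : Agree l c d) (h' : Agree l d e) : Agree l c e :=
  fun j hj => (h j hj).trans (h' j hj)

theorem Agree.mono {k l c d : M} (h : Agree l c d) (hk : k ≤ l) : Agree k c d :=
  fun j hj => h j (hj.trans_le hk)

theorem Agree.succ {l c d : M} (h : Agree l c d) (h' : InFin l c ↔ InFin l d) :
    Agree (l + 1) c d := fun j hj => by
  rcases (lt_add_one_iff_le.1 hj).lt_or_eq with hj | rfl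
  · exact h j hj
  · exact h'

/-- `c` is the least number agreeing with `d` below `l`. -/
def IsLeastAgree (l c d : M) : Prop := Agree l c d ∧ ∀ c', c' < c → ¬ Agree l c' d

instance IsBdd.isLeastAgree (r s t : Γ → M) [IsTerm M r] [IsTerm M s] [IsTerm M t] :
    IsBdd M (fun γ => IsLeastAgree (r γ) (s γ) (t γ)) :=
  IsBdd.comp₃ (P := IsLeastAgree) (by unfold IsLeastAgree; infer_instance) r s t

/-- Many numbers give the same string of length `l`; the least one serves as the name of that node,
so that a set of pairs can assign a choice to each node. -/
theorem exists_isLeastAgree (l d : M) : ∃ c, IsLeastAgree l c d := by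
  obtain ⟨c, -, hc⟩ := exists_least (P := fun c => Agree l c d) inferInstance (Agree.refl l d)
  exact ⟨c, hc⟩

theorem IsLeastAgree.le {l c d : M} (h : IsLeastAgree l c d) : c ≤ d := by
  by_contra hlt
  exact h.2 d (not_le.1 hlt) (Agree.refl l d)

theorem IsLeastAgree.unique {l c c' d : M} (h : IsLeastAgree l c d) (h' : IsLeastAgree l c' d) :
    c = c' := by
  rcases lt_trichotomy c c' with hlt | e | hlt
  · exact (h'.2 c hlt h.1).elim
  · exact e
  · exact (h.2 c' hlt h'.1).elim

theorem IsLeastAgree.of_agree {l c d d' : M} (h : IsLeastAgree l c d) (hd : Agree l d d') :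
    IsLeastAgree l c d' :=
  ⟨h.1.trans hd, fun c' hc' h' => h.2 c' hc' (h'.trans hd.symm)⟩

/-- The choice made by `X` at the string of length `l` given by `d`. -/
def Turn (X : Set M) (l d : M) : Prop := ∃ c, IsLeastAgree l c d ∧ pair c l ∈ X

theorem isBdd_turn (X : Set M) [Fact (X ∈ sets (M := M))] :
    IsBdd M (fun γ : M × M × PUnit.{u + 1} => Turn X γ.1 γ.2.1) :=
  (inferInstance : IsBdd M fun γ : M × M × PUnit.{u + 1} =>
    ∃ c, c ≤ γ.2.1 ∧ (IsLeastAgree γ.1 c γ.2.1 ∧ pair c γ.1 ∈ X)).congr fun _ =>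
    ⟨fun ⟨c, h, h'⟩ => ⟨c, h.le, h, h'⟩, fun ⟨c, _, h⟩ => ⟨c, h⟩⟩

instance IsBdd.turn (X : Set M) [Fact (X ∈ sets (M := M))] (s t : Γ → M) [IsTerm M s]
    [IsTerm M t] : IsBdd M (fun γ => Turn X (s γ) (t γ)) :=
  (isBdd_turn X).comp₂ s t

theorem turn_congr {X : Set M} {l d d' : M} (h : Agree l d d') : Turn X l d ↔ Turn X l d' :=
  ⟨fun ⟨c, hc, hX⟩ => ⟨c, hc.of_agree h, hX⟩, fun ⟨c, hc, hX⟩ => ⟨c, hc.of_agree h.symm, hX⟩⟩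

theorem IsLeastAgree.turn_iff {X : Set M} {l c d : M} (h : IsLeastAgree l c d) :
    Turn X l d ↔ pair c l ∈ X :=
  ⟨fun ⟨_, hc, hX⟩ => h.unique hc ▸ hX, fun hX => ⟨c, h, hX⟩⟩

/-- The first `l` bits of `d` are the choices made by `X`. -/
def Follows (X : Set M) (d l : M) : Prop := ∀ j, j < l → (InFin j d ↔ Turn X j d)

instance IsBdd.follows (X : Set M) [Fact (X ∈ sets (M := M))] (s t : Γ → M) [IsTerm M s]
    [IsTerm M t] : IsBdd M (fun γ => Follows X (s γ) (t γ)) :=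
  IsBdd.comp₂ (P := Follows X) (by unfold Follows; infer_instance) s t

theorem Follows.mono {X : Set M} {d k l : M} (h : Follows X d l) (hk : k ≤ l) : Follows X d k :=
  fun j hj => h j (hj.trans_le hk)

theorem Follows.agree {X : Set M} (hX : X ∈ sets (M := M)) {d d' l : M} (h : Follows X d l)
    (h' : Follows X d' l) : Agree l d d' := by
  have : Fact (X ∈ sets (M := M)) := ⟨hX⟩
  have key : ∀ k : M, k ≤ l → Agree k d d' := by
    refine sig_induction inferInstance (fun _ j hj => (hM.out.not_lt_zero j hj).elim)
      fun k ih hk => ?_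
    have ih := ih (le_self_add.trans hk)
    have hk := add_one_le_iff_lt.1 hk
    exact ih.succ (by rw [h k hk, h' k hk, turn_congr ih])
  exact key l le_rfl

theorem exists_follows {X : Set M} (hX : X ∈ sets (M := M)) (l : M) : ∃ d, Follows X d l := by
  have : Fact (X ∈ sets (M := M)) := ⟨hX⟩
  refine sig_induction (P := fun l : M => ∃ d, Follows X d l) inferInstance
    ⟨0, fun j hj => (hM.out.not_lt_zero j hj).elim⟩ (fun l ih => ?_) l
  obtain ⟨d, hd⟩ := ih
  -- The string is prolonged by the bit that `X` chooses; that choice depends only on the bits below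
  -- `l`.
  obtain ⟨Y, hY, hY'⟩ := exists_set_of_isBdd
    (fun i : M => i < l ∧ InFin i d ∨ i = l ∧ Turn X l d)
  obtain ⟨d', -, hd'⟩ := exists_isFinCode (l + 1) hY
  have hag : Agree l d d' := fun j hj => by
    rw [hd', hY']
    simp [hj, hj.ne, lt_add_one_iff_le.2 hj.le]
  refine ⟨d', fun j hj => ?_⟩
  rcases (lt_add_one_iff_le.1 hj).lt_or_eq with hj | rfl
  · rw [← hag j hj, hd j hj, turn_congr (hag.mono hj.le)]
  · rw [hd', hY', turn_congr hag]
    simp [hj]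

/-! ### Strings and their extensions in the tree. -/

/-- Some sequence in `T` of length `n` has the first `n` bits of `e`. -/
def InTree (T : Set M) (e n : M) : Prop :=
  ∃ σ, σ ∈ T ∧ IsBinSeqLen σ n ∧ ∀ j, j < n → (InFin (pair j 1) σ ↔ InFin j e)

theorem exists_seq_of_code (e n : M) :
    ∃ σ, IsBinSeqLen σ n ∧ ∀ j, j < n → (InFin (pair j 1) σ ↔ InFin j e) := by
  obtain ⟨Y, hY, hY'⟩ := exists_set_of_isBdd (fun i : M => InFin i e)
  obtain ⟨σ, hσ, hb⟩ := exists_isBinSeqLen n hY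
  exact ⟨σ, hσ, fun j hj => by simp [hb, hY', hj]⟩

theorem not_inTree_iff {T : Set M} {e n : M} : ¬ InTree T e n ↔
    ∃ σ, ¬ σ ∈ T ∧ IsBinSeqLen σ n ∧ ∀ j, j < n → (InFin (pair j 1) σ ↔ InFin j e) := by
  obtain ⟨σ, hσ, hb⟩ := exists_seq_of_code e n
  constructor
  · exact fun h => ⟨σ, fun hT => h ⟨σ, hT, hσ, hb⟩, hσ, hb⟩
  · rintro ⟨τ, hτT, hτ, hτb⟩ ⟨ρ, hρT, hρ, hρb⟩
    rw [hτ.ext hρ fun j hj => (hτb j hj).trans (hρb j hj).symm] at hτT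
    exact hτT hρT

/-- The sequence with given bits and length exists and is unique, so its absence from `T` is also
Σ⁰₁ and Δ⁰₁ comprehension applies. -/
theorem exists_set_inTree {T : Set M} (hT : T ∈ sets (M := M)) :
    ∃ U ∈ sets (M := M), ∀ e n, pair e n ∈ U ↔ InTree T e n := by
  have : Fact (T ∈ sets (M := M)) := ⟨hT⟩
  have h : IsSig M (fun γ : M × PUnit.{u + 1} => ∃ e n, γ.1 = pair e n ∧ InTree T e n) := by
    unfold InTree
    infer_instance
  have h' : IsSig M (fun γ : M × PUnit.{u + 1} => ¬ ∃ e n, γ.1 = pair e n ∧ InTree T e n) := by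
    refine (inferInstance : IsSig M (fun γ : M × PUnit.{u + 1} =>
      (¬ ∃ e, e ≤ γ.1 ∧ ∃ n, n ≤ γ.1 ∧ γ.1 = pair e n) ∨ ∃ e n, γ.1 = pair e n ∧
      ∃ σ, ¬ σ ∈ T ∧ IsBinSeqLen σ n ∧
        ∀ j, j < n → (InFin (pair j 1) σ ↔ InFin j e))).congr fun γ => ?_
    simp only [← not_inTree_iff]
    constructor
    · intro h
      by_cases hp : ∃ e, e ≤ γ.1 ∧ ∃ n, n ≤ γ.1 ∧ γ.1 = pair e n
      · obtain ⟨e, -, n, -, e1⟩ := hp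
        exact .inr ⟨e, n, e1, fun hT => h ⟨e, n, e1, hT⟩⟩
      · exact .inl hp
    · rintro (h | ⟨e, n, e1, h⟩) ⟨e', n', e1', h'⟩
      · exact h ⟨e', e1' ▸ left_le_pair _ _, n', e1' ▸ right_le_pair _ _, e1'⟩
      · obtain ⟨rfl, rfl⟩ := pair_inj.1 (e1.symm.trans e1')
        exact h h'
  obtain ⟨U, hU, hU'⟩ := exists_set (P := fun i => ∃ e n, i = pair e n ∧ InTree T e n) h h'
  refine ⟨U, hU, fun e n => (hU' _).trans ⟨?_, fun h => ⟨e, n, rfl, h⟩⟩⟩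
  rintro ⟨e', n', e1, h⟩
  obtain ⟨rfl, rfl⟩ := pair_inj.1 e1
  exact h

theorem InTree.of_agree {T : Set M} {d e n : M} (h : InTree T d n) (hde : Agree n d e) :
    InTree T e n := by
  obtain ⟨σ, hT, hσ, hb⟩ := h
  exact ⟨σ, hT, hσ, fun j hj => (hb j hj).trans (hde j hj)⟩

theorem InTree.mono {T : Set M} (hT : IsBinTree T) {e k n : M} (h : InTree T e n) (hk : k ≤ n) :
    InTree T e k := by
  obtain ⟨σ, hσT, hσ, hb⟩ := h
  obtain ⟨ρ, hρ, hρb⟩ := exists_seq_of_code e k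
  exact ⟨ρ, hT.2 ρ σ hσT (hρ.isInitSeg hσ hk fun j hj =>
    (hρb j hj).trans (hb j (hj.trans_le hk)).symm), hρ, hρb⟩

theorem exists_inTree {T : Set M} (hT : IsBinTree T) (hinf : IsInfiniteIn T) (n : M) :
    ∃ e, InTree T e n := by
  obtain ⟨b, hb⟩ := exists_isCodeBound (pair n 1 + 1)
  -- Sequences of length at most `n` have codes up to `b`, so an element of `T` beyond `b` is longer
  -- than `n` and can be truncated.
  obtain ⟨σ, hσT, hσb⟩ : ∃ σ ∈ T, b < σ := by
    by_contra hc
    push Not at hc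
    exact hinf ⟨b + 1, fun σ hσ => lt_add_one_iff_le.2 (hc σ hσ)⟩
  obtain ⟨l, hl⟩ := (hT.1 σ hσT).exists_length
  obtain ⟨Y, hY, hY'⟩ := exists_set_of_isBdd (fun i : M => InFin (pair i 1) σ)
  obtain ⟨e, -, he⟩ := exists_isFinCode l hY
  have hln : n ≤ l := by
    by_contra hlt
    exact (hl.le_bound (not_le.1 hlt).le hb).not_gt hσb
  refine ⟨e, InTree.mono hT ⟨σ, hσT, hl, fun j hj => ?_⟩ hln⟩
  rw [he, hY']
  simp [hj]

/-- Quantification over finite sets can be bounded if only the elements below `k` matter. -/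
theorem not_exists_iff_of_agree (k : M) {P : M → Prop} (hP : ∀ d e, Agree k d e → P d → P e) :
    (¬ ∃ e, P e) ↔ ∃ b, IsCodeBound k b ∧ ¬ ∃ e, e ≤ b ∧ P e := by
  constructor
  · intro h
    obtain ⟨b, hb⟩ := exists_isCodeBound k
    exact ⟨b, hb, fun ⟨e, _, he⟩ => h ⟨e, he⟩⟩
  · rintro ⟨b, hb, h⟩ ⟨e, he⟩
    obtain ⟨Y, hY, hY'⟩ := exists_set_of_isBdd (fun i : M => InFin i e)
    obtain ⟨c, hc, -, hcY⟩ := hb.exists_triple hY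
    exact h ⟨c, hc, hP e c (fun j hj => by simp [hcY, hY', hj]) he⟩

/-- The string of length `l` given by `c` has an extension of length `n` in `T`. -/
def Alive (T : Set M) (l c n : M) : Prop := ∃ e, Agree l c e ∧ InTree T e n

/-- The string of length `l` given by `c`, followed by the bit `1`, has an extension of length `n`
in `T`. -/
def Alive₁ (T : Set M) (l c n : M) : Prop := ∃ e, Agree l c e ∧ InFin l e ∧ InTree T e n

/-- The string of length `l` given by `c`, followed by the bit `0`, has an extension of length `n`
in `T`. -/
def Alive₀ (T : Set M) (l c n : M) : Prop := ∃ e, Agree l c e ∧ ¬ InFin l e ∧ InTree T e n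

/-- Being dead at length `n` is Σ⁰₁: only bits below `n + l + 1` matter, a range that also includes
the bit `l` needed in the two variants below. -/
theorem not_alive_iff {T : Set M} {l c n : M} : ¬ Alive T l c n ↔
    ∃ b, IsCodeBound (n + l + 1) b ∧ ¬ ∃ e, e ≤ b ∧ (Agree l c e ∧ InTree T e n) :=
  not_exists_iff_of_agree (n + l + 1) fun _ _ h h' =>
    ⟨h'.1.trans (h.mono (le_add_self.trans le_self_add)),
      h'.2.of_agree (h.mono (le_self_add.trans le_self_add))⟩

theorem not_alive₁_iff {T : Set M} {l c n : M} : ¬ Alive₁ T l c n ↔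
    ∃ b, IsCodeBound (n + l + 1) b ∧
      ¬ ∃ e, e ≤ b ∧ (Agree l c e ∧ InFin l e ∧ InTree T e n) :=
  not_exists_iff_of_agree (n + l + 1) fun _ _ h h' =>
    ⟨h'.1.trans (h.mono (le_add_self.trans le_self_add)),
      (h l (lt_add_one_iff_le.2 le_add_self)).1 h'.2.1,
      h'.2.2.of_agree (h.mono (le_self_add.trans le_self_add))⟩

theorem not_alive₀_iff {T : Set M} {l c n : M} : ¬ Alive₀ T l c n ↔
    ∃ b, IsCodeBound (n + l + 1) b ∧
      ¬ ∃ e, e ≤ b ∧ (Agree l c e ∧ ¬ InFin l e ∧ InTree T e n) :=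
  not_exists_iff_of_agree (n + l + 1) fun _ _ h h' =>
    ⟨h'.1.trans (h.mono (le_add_self.trans le_self_add)),
      fun hl => h'.2.1 ((h l (lt_add_one_iff_le.2 le_add_self)).2 hl),
      h'.2.2.of_agree (h.mono (le_self_add.trans le_self_add))⟩

theorem Alive₁.mono {T : Set M} (hT : IsBinTree T) {l c k n : M} (h : Alive₁ T l c n)
    (hk : k ≤ n) : Alive₁ T l c k := by
  obtain ⟨e, h1, h2, h3⟩ := h
  exact ⟨e, h1, h2, h3.mono hT hk⟩

theorem Alive₀.mono {T : Set M} (hT : IsBinTree T) {l c k n : M} (h : Alive₀ T l c n)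
    (hk : k ≤ n) : Alive₀ T l c k := by
  obtain ⟨e, h1, h2, h3⟩ := h
  exact ⟨e, h1, h2, h3.mono hT hk⟩

/-! ### Choosing bits and following them to a path. -/

/-- There is a set that, at each string, turns towards a bit which survives longest in `T`. -/
theorem InitialIntervalSeparation.exists_choice (h : InitialIntervalSeparation M) {T : Set M}
    (hTs : T ∈ sets (M := M)) (hT : IsBinTree T) :
    ∃ X ∈ sets (M := M), ∀ l c n,
      (Alive₁ T l c n → ¬ Alive₀ T l c n → pair c l ∈ X) ∧
      (Alive₀ T l c n → ¬ Alive₁ T l c n → pair c l ∉ X) := by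
  obtain ⟨U, hU, hUT⟩ := exists_set_inTree hTs
  have : Fact (U ∈ sets (M := M)) := ⟨hU⟩
  have hφ : IsSigma01 fun x : M =>
      ∃ l c n, x = pair c l ∧ Alive₁ T l c n ∧ ¬ Alive₀ T l c n := by
    simp only [not_alive₀_iff, Alive₁, ← hUT]
    exact isSigma01_iff.2 inferInstance
  have hψ : IsSigma01 fun x : M =>
      ∃ l c n, x = pair c l ∧ Alive₀ T l c n ∧ ¬ Alive₁ T l c n := by
    simp only [not_alive₁_iff, Alive₀, ← hUT]
    exact isSigma01_iff.2 inferInstance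
  obtain ⟨X, hX, hs⟩ := h.sigma01_separation hφ hψ (by
    rintro x ⟨l, c, n, rfl, h1, h2⟩ ⟨l', c', n', e, h3, h4⟩
    obtain ⟨rfl, rfl⟩ := pair_inj.1 e
    -- Extensions can be truncated, so the two claims contradict each other at the smaller length.
    rcases le_total n n' with hn | hn
    · exact h2 (h3.mono hT hn)
    · exact h4 (h1.mono hT hn))
  exact ⟨X, hX, fun l c n => ⟨fun h1 h2 => (hs _).1 ⟨l, c, n, rfl, h1, h2⟩,
    fun h1 h2 => (hs _).2 ⟨l, c, n, rfl, h1, h2⟩⟩⟩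

/-- If the string of length `k` extends to length `n` but its prolongation along `d` does not, every
such extension takes the other bit; then `X` had to choose that other bit, contrary to `d` following
`X`. So death at `n` descends to the root, which is impossible in an infinite tree. -/
theorem alive_of_follows {T X : Set M} (hTs : T ∈ sets (M := M)) (hT : IsBinTree T)
    (hinf : IsInfiniteIn T)
    (hX : ∀ l c n, (Alive₁ T l c n → ¬ Alive₀ T l c n → pair c l ∈ X) ∧
      (Alive₀ T l c n → ¬ Alive₁ T l c n → pair c l ∉ X))
    {d l : M} (hd : Follows X d l) (n : M) : Alive T l d n := by
  obtain ⟨U, hU, hUT⟩ := exists_set_inTree hTs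
  have : Fact (U ∈ sets (M := M)) := ⟨hU⟩
  have step (k : M) (hk : k < l) (hn : ¬ Alive T (k + 1) d n) : ¬ Alive T k d n := by
    rintro ⟨e, he, heT⟩
    obtain ⟨c, hc⟩ := exists_isLeastAgree k d
    have hturn := (hd k hk).trans hc.turn_iff
    have hed : ¬ (InFin k d ↔ InFin k e) := fun h => hn ⟨e, he.succ h, heT⟩
    by_cases hkd : InFin k d
    · have hke : ¬ InFin k e := fun h => hed (by simp [hkd, h])
      refine (hX k c n).2 ⟨e, hc.1.trans he, hke, heT⟩ ?_ (hturn.1 hkd)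
      rintro ⟨e', he', hke', heT'⟩
      exact hn ⟨e', (hc.1.symm.trans he').succ (by simp [hkd, hke']), heT'⟩
    · have hke : InFin k e := by
        by_contra h
        exact hed (by simp [hkd, h])
      refine hkd (hturn.2 ((hX k c n).1 ⟨e, hc.1.trans he, hke, heT⟩ ?_))
      rintro ⟨e', he', hke', heT'⟩
      exact hn ⟨e', (hc.1.symm.trans he').succ (by simp [hkd, hke']), heT'⟩
  by_contra hn
  -- Descent from `l` as an upward induction: `y` stands for `l - x`, and the claim is vacuous once
  -- `x` exceeds `l`. At `x = l` the root is reached.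
  have key : ∀ x : M, ∃ y, (y + x = l ∨ l < x) ∧ (l < x ∨ ¬ Alive T y d n) := by
    refine sig_induction ?_ ⟨l, by simp, .inr hn⟩ fun x ih => ?_
    · simp only [not_alive_iff, ← hUT]
      infer_instance
    · rcases lt_or_ge l (x + 1) with hx | hx
      · exact ⟨0, .inr hx, .inl hx⟩
      · have hx' : ¬ l < x := not_lt.2 (le_self_add.trans hx)
        obtain ⟨y, hy, hy'⟩ := ih
        replace hy := hy.resolve_right hx'
        replace hy' := hy'.resolve_left hx'
        have hy0 : 0 < y := by
          rw [pos_iff_ne_zero]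
          rintro rfl
          rw [_root_.zero_add] at hy
          rw [hy] at hx
          exact (lt_add_one_iff_le.2 le_rfl).not_ge hx
        obtain ⟨z, hz⟩ := lt_iff_exists_add_one.1 hy0
        rw [_root_.zero_add] at hz
        subst hz
        have e : z + (x + 1) = l := by
          rw [← hy]
          ring
        exact ⟨z, .inl e, .inr (step z (lt_iff_exists_add_one.2 ⟨x, by rw [← e]; ring⟩) hy')⟩
  obtain ⟨y, hy, hy'⟩ := key l
  obtain rfl : y = 0 := by simpa using hy
  obtain ⟨e, he⟩ := exists_inTree hT hinf n
  exact (hy'.resolve_left (lt_irrefl l)) ⟨e, fun j hj => (hM.out.not_lt_zero j hj).elim, he⟩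

theorem InitialIntervalSeparation.weakKonig (h : InitialIntervalSeparation M) :
    WeakKonig M := by
  intro T hTs hT hinf
  obtain ⟨X, hX, hXT⟩ := h.exists_choice hTs hT
  have : Fact (X ∈ sets (M := M)) := ⟨hX⟩
  let P : M → Prop := fun i => ∃ j v d, i = pair j v ∧ Follows X d (j + 1) ∧
    (v = 1 ∧ InFin j d ∨ v = 0 ∧ ¬ InFin j d)
  have hP : IsSig M (fun γ : M × PUnit.{u + 1} => P γ.1) := by
    unfold P
    infer_instance
  -- Strings following `X` exist at every length and any two agree, so a single one with the wrong
  -- bit already refutes `P`. Hence the complement is Σ⁰₁.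
  have hP' : IsSig M (fun γ : M × PUnit.{u + 1} => ¬ P γ.1) := by
    refine (inferInstance : IsSig M (fun γ : M × PUnit.{u + 1} =>
      (¬ ∃ j, j ≤ γ.1 ∧ ∃ v, v ≤ γ.1 ∧ γ.1 = pair j v) ∨ ∃ j v d, γ.1 = pair j v ∧
        Follows X d (j + 1) ∧ ¬ (v = 1 ∧ InFin j d ∨ v = 0 ∧ ¬ InFin j d))).congr fun γ => ?_
    constructor
    · intro h
      by_cases hp : ∃ j, j ≤ γ.1 ∧ ∃ v, v ≤ γ.1 ∧ γ.1 = pair j v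
      · obtain ⟨j, -, v, -, e⟩ := hp
        obtain ⟨d, hd⟩ := exists_follows hX (j + 1)
        exact .inr ⟨j, v, d, e, hd, fun h' => h ⟨j, v, d, e, hd, h'⟩⟩
      · exact .inl hp
    · rintro (h | ⟨j, v, d, e, hd, h⟩) ⟨j', v', d', e', hd', h'⟩
      · exact h ⟨j', e' ▸ left_le_pair _ _, v', e' ▸ right_le_pair _ _, e'⟩
      · obtain ⟨rfl, rfl⟩ := pair_inj.1 (e.symm.trans e')
        rw [hd.agree hX hd' j (lt_add_one_iff_le.2 le_rfl)] at h
        exact h h'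
  obtain ⟨F, hF, hFP⟩ := exists_set hP hP'
  have memF {j v d : M} (hd : Follows X d (j + 1)) :
      pair j v ∈ F ↔ (v = 1 ∧ InFin j d ∨ v = 0 ∧ ¬ InFin j d) := by
    rw [hFP]
    constructor
    · rintro ⟨j', v', d', e, hd', h'⟩
      obtain ⟨rfl, rfl⟩ := pair_inj.1 e
      rwa [hd.agree hX hd' j (lt_add_one_iff_le.2 le_rfl)]
    · exact fun h => ⟨j, v, d, rfl, hd, h⟩
  refine ⟨F, hF, ⟨fun i hi => ?_, fun j => ?_⟩, fun n => ?_⟩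
  · obtain ⟨j, v, -, h, -⟩ := (hFP i).1 hi
    exact ⟨j, v, h⟩
  · obtain ⟨d, hd⟩ := exists_follows hX (j + 1)
    simp only [memF hd]
    by_cases hj : InFin j d
    · exact ⟨1, .inl ⟨rfl, hj⟩, by simp [hj]⟩
    · exact ⟨0, .inr ⟨rfl, hj⟩, by simp [hj]⟩
  · obtain ⟨d, hd⟩ := exists_follows hX n
    -- Taking the string length and the extension length both equal to `n` gives an element of `T`
    -- whose bits are those of `d` itself.
    obtain ⟨e, he, σ, hσT, hσ, hb⟩ := alive_of_follows hTs hT hinf hXT hd n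
    refine ⟨σ, hσT, hσ.1, fun i hi => ?_⟩
    obtain ⟨j, hj, h⟩ := hσ.inFin_iff.1 hi
    rw [hb j hj, ← he j hj] at h
    rcases h with ⟨rfl, h⟩ | ⟨rfl, h⟩
    · exact (memF (hd.mono (add_one_le_iff_lt.2 hj))).2 (.inl ⟨rfl, h⟩)
    · exact (memF (hd.mono (add_one_le_iff_lt.2 hj))).2 (.inr ⟨rfl, h⟩)

end

end RevMath

theorem lemma3p1 (M : Type u) [RevMath.L2Structure M] (hM : RevMath.ModelsRCA0 M) :
    List.TFAE [RevMath.ModelsWKL0 M,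
      RevMath.Sigma01InitialIntervalSeparation M,
      RevMath.InitialIntervalSeparation M] := by
  have : Fact (RevMath.ModelsRCA0 M) := ⟨hM⟩
  tfae_have 1 → 2 := fun h => h.2.sigma01InitialIntervalSeparation
  tfae_have 2 → 3 := fun h => h.initialIntervalSeparation
  tfae_have 3 → 1 := fun h => ⟨hM, h.weakKonig⟩
  tfae_finish
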